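/- Let $N\in\{2,3\}$, let $\Omega\subset\mathbb R^N$ be a bounded open set, and let $T>0$. Write $D(v)=\frac12(\nabla v+\nabla v^{T})$, $A:B=\sum_{i,k}A_{ik}B_{ik}$, $|A|^2=A:A$. Let $H^1_0(\Omega)$ be the closure of $C_c^\infty(\Omega)^N$ in $H^1(\Omega)^N$, with $\|v\|_{H^1_0}=\|\nabla v\|_{L^2}$, let $H^1_{0,\sigma}(\Omega)=\{v\in H^1_0(\Omega):\operatorname{div}v=0\}$, and let $H^{-1}_\sigma(\Omega)$ be its dual, with duality product $\langle\cdot,\cdot\rangle$. Let $F:(0,\infty)\to(0,\infty)$ belong to $W^{1,\infty}_{loc}((0,\infty))$ (i.e. be locally Lipschitz), let $t\mapsto tF(t)$ be non-decreasing, and let there be $\alpha\in[0,1]$, $t_0>0$, $K>0$ with $F(t)\le Kt^{-\alpha}$ for $t\ge t_0$. Put $G(t)=\int_0^t sF(s)\,ds$, $j(v)=\int_\Omega G(|D(v)|)\,dx$ and $\langle j'(v),w\rangle=\int_\Omega F(|D(v)|)\,D(v):D(w)\,dx$, the integrand being $0$ where $D(v)=0$. Let $u_0\in H^1_{0,\sigma}(\Omega)$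 and $f\in L^2((0,T),H^{-1}_\sigma(\Omega))$. A weak solution is a function $u\in L^2((0,T),H^1_{0,\sigma}(\Omega))\cap L^\infty((0,T),L^2(\Omega)^N)$ with distributional time derivative $u'\in L^{4/N}((0,T),H^{-1}_\sigma(\Omega))$ and $u|_{t=0}=u_0$ such that, for every $\varphi\in L^2((0,T),H^1_{0,\sigma}(\Omega))$, all the following time integrals exist and $$\int_0^T\langle u',\varphi-u\rangle\,dt+\int_0^T\!\!\int_\Omega D(u):D(\varphi-u)\,dx\,dt-\int_0^T\!\!\int_\Omega(u\cdot\nabla u)\cdot\varphi\,dx\,dt+\int_0^T\big(j(\varphi)-j(u)\big)\,dt\ \ge\ \int_0^T\langle f,\varphi-u\rangle\,dt .$$ Suppose that there is $\theta>0$ with $G(t)=\theta t^2F(\theta t)$ for all $t\in(0,T)$. Then every weak solution $u$ satisfies an energy equality: there is a function $\eta:(0,T)\to(0,1]$ such that for almost all $s\in(0,T)$ the function $\tau\mapsto j(\eta(s)u(s)+\tau u(s))$ has derivative $\langle j'(\eta(s)u(s)),u(s)\rangle$ at $\tau=0$, the function $s\mapsto\eta(s)^{-1}\langle j'(\eta(s)u(s)),u(s)\rangle$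 is integrable on $(0,T)$, and for almost all $t\in(0,T)$ $$\tfrac12\|u(t)\|_{L^2}^2+\tfrac12\int_0^t\|u(s)\|_{H^1_0}^2\,ds+\int_0^t\frac1{\eta(s)}\langle j'(\eta(s)u(s)),u(s)\rangle\,ds=\tfrac12\|u_0\|_{L^2}^2+\int_0^t\langle f(s),u(s)\rangle\,ds .$$ Moreover, for every $\alpha\in[0,1]$ the power law $F(t)=t^{-\alpha}$ satisfies the assumptions made on $F$ above, and there is $\theta>0$ with $G(t)=\theta t^2F(\theta t)$ for all $t>0$. -/

import Mathlib

open MeasureTheory Set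
open scoped ENNReal ContDiff

noncomputable section

namespace ShearThinning

/-- Vectors of `ℝ^N`, with the Euclidean norm. -/
abbrev Vec (N : ℕ) : Type := EuclideanSpace ℝ (Fin N)

/-- Real `N × N` matrices with the scalar product `A : B = ∑ A i j * B i j` (Frobenius norm). -/
abbrev Mat (N : ℕ) : Type := EuclideanSpace ℝ (Fin N × Fin N)

/-- The symmetric part `(A + Aᵀ) / 2`. -/
def symPart {N : ℕ} (A : Mat N) : Mat N :=
  WithLp.toLp 2 fun p => (A p + A p.swap) / 2

/-- The Jacobian matrix: the entry `(i, k)` is `∂ φ_i / ∂ x_k`. -/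
def jacobian {N : ℕ} (φ : Vec N → Vec N) (x : Vec N) : Mat N :=
  WithLp.toLp 2 fun p => fderiv ℝ φ x (EuclideanSpace.single p.2 1) p.1

/-! ### The function spaces -/

/-- Pairs (field, gradient) in `L²(Ω)^N × L²(Ω)^{N × N}`. On this Hilbert space the norm is
`(‖v‖² + ‖∇ v‖²)^{1/2}`. -/
abbrev GraphSpace {N : ℕ} (Ω : Set (Vec N)) : Type :=
  WithLp 2 (Lp (Vec N) 2 (volume.restrict Ω) × Lp (Mat N) 2 (volume.restrict Ω))

/-- `H¹₀(Ω)^N`, the closure of `C_c^∞(Ω)^N` in `H¹(Ω)^N`. A function `v` is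
represented by the pair `(v, ∇ v)`; the second component is determined by the first. -/
def H10 {N : ℕ} (Ω : Set (Vec N)) : Submodule ℝ (GraphSpace Ω) :=
  (Submodule.span ℝ {p : GraphSpace Ω | ∃ φ : Vec N → Vec N,
    ContDiff ℝ ∞ φ ∧ HasCompactSupport φ ∧ tsupport φ ⊆ Ω ∧
    p.fst =ᵐ[volume.restrict Ω] φ ∧
    p.snd =ᵐ[volume.restrict Ω] jacobian φ}).topologicalClosure

/-- `H¹_{0,σ}(Ω)`, the divergence free elements of `H¹₀(Ω)^N`. The norm of this type is the one
of `H¹`, which is equivalent to `‖∇ v‖_{L²}` for bounded `Ω` (Poincaré); so the Bochner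
spaces over it and over its dual are the usual ones. -/
def H10σ {N : ℕ} (Ω : Set (Vec N)) : Submodule ℝ (GraphSpace Ω) where
  carrier := {p | p ∈ H10 Ω ∧ ∀ᵐ x ∂(volume.restrict Ω), ∑ i : Fin N, p.snd x (i, i) = 0}
  zero_mem' := by
    refine ⟨zero_mem _, ?_⟩
    filter_upwards [Lp.coeFn_zero (Mat N) 2 (volume.restrict Ω)] with x hx
    have h : ((0 : GraphSpace Ω).snd : Vec N → Mat N) x = 0 := hx
    simp only [h, PiLp.zero_apply, Finset.sum_const_zero]
  add_mem' := by
    rintro p q ⟨hp, hp'⟩ ⟨hq, hq'⟩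
    refine ⟨add_mem hp hq, ?_⟩
    filter_upwards [hp', hq', Lp.coeFn_add p.snd q.snd] with x h1 h2 h3
    have h : ((p + q).snd : Vec N → Mat N) x = p.snd x + q.snd x := h3
    simp only [h, PiLp.add_apply, Finset.sum_add_distrib, h1, h2, add_zero]
  smul_mem' := by
    rintro c p ⟨hp, hp'⟩
    refine ⟨Submodule.smul_mem _ c hp, ?_⟩
    filter_upwards [hp', Lp.coeFn_smul c p.snd] with x h1 h3
    have h : ((c • p).snd : Vec N → Mat N) x = c • p.snd x := h3
    simp only [h, PiLp.smul_apply, smul_eq_mul, ← Finset.mul_sum, h1, mul_zero]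

/-- `H^{-1}_σ(Ω)`, the dual of `H¹_{0,σ}(Ω)`; the duality product is evaluation. -/
abbrev Hneg1σ {N : ℕ} (Ω : Set (Vec N)) : Type := StrongDual ℝ (H10σ Ω)

/-- The field `v` itself, as an element of `L²(Ω)^N`. -/
def field {N : ℕ} {Ω : Set (Vec N)} (v : H10σ Ω) : Lp (Vec N) 2 (volume.restrict Ω) :=
  (v : GraphSpace Ω).fst

/-- The gradient `∇ v`, as an element of `L²(Ω)^{N × N}`. -/
def grad {N : ℕ} {Ω : Set (Vec N)} (v : H10σ Ω) : Lp (Mat N) 2 (volume.restrict Ω) :=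
  (v : GraphSpace Ω).snd

/-- The symmetric gradient `D(v) = (∇ v + (∇ v)ᵀ) / 2`. -/
def symGrad {N : ℕ} {Ω : Set (Vec N)} (v : H10σ Ω) (x : Vec N) : Mat N :=
  symPart (grad v x)

/-- Lebesgue measure on the time interval `(0, T)`. -/
abbrev timeMeasure (T : ℝ) : Measure ℝ := volume.restrict (Ioo 0 T)

/-! ### The viscosity coefficient and the functional `j` -/

/-- The standing assumptions on the viscosity coefficient `F : (0, ∞) → (0, ∞)` (values of `F`
outside `(0, ∞)` play no role). For `F` with `t ↦ t F(t)` monotone, local Lipschitz continuity on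
`(0, ∞)` is the same as membership in `W^{1,∞}_loc`. -/
structure IsViscosityCoeff (F : ℝ → ℝ) : Prop where
  pos : ∀ t, 0 < t → 0 < F t
  locallyLipschitz : LocallyLipschitzOn (Ioi 0) F
  mono : MonotoneOn (fun t => t * F t) (Ioi 0)
  growth : ∃ α ∈ Icc (0 : ℝ) 1, ∃ t₀ > 0, ∃ K > 0, ∀ t ≥ t₀, F t ≤ K * t ^ (-α)

/-- `G(t) = ∫₀ᵗ s F(s) ds`. -/
def G (F : ℝ → ℝ) (t : ℝ) : ℝ := ∫ s in (0 : ℝ)..t, s * F s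

/-- `j(v) = ∫_Ω G(|D(v)|) dx`. -/
def j {N : ℕ} {Ω : Set (Vec N)} (F : ℝ → ℝ) (v : H10σ Ω) : ℝ :=
  ∫ x in Ω, G F ‖symGrad v x‖

/-- `⟨j'(v), w⟩ = ∫_Ω F(|D(v)|) D(v) : D(w) dx`; the integrand is `0` where `D(v) = 0`. -/
def jDeriv {N : ℕ} {Ω : Set (Vec N)} (F : ℝ → ℝ) (v w : H10σ Ω) : ℝ :=
  ∫ x in Ω, F ‖symGrad v x‖ * inner ℝ (symGrad v x) (symGrad w x)

/-- `∫_Ω D(v) : D(w) dx`. -/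
def viscousForm {N : ℕ} {Ω : Set (Vec N)} (v w : H10σ Ω) : ℝ :=
  ∫ x in Ω, inner ℝ (symGrad v x) (symGrad w x)

/-- `∫_Ω (v · ∇ v) · w dx`, where `(v · ∇ v)_i = ∑ k, v_k ∂_k v_i`. -/
def convection {N : ℕ} {Ω : Set (Vec N)} (v w : H10σ Ω) : ℝ :=
  ∫ x in Ω, ∑ i : Fin N, (∑ k : Fin N, field v x k * grad v x (i, k)) * field w x i

/-! ### Weak solutions -/

/-- `u'` is the derivative of `u` in the sense of distributions on `(0, T)` with values in
`H^{-1}_σ(Ω)`, where `H¹_{0,σ} ⊆ H^{-1}_σ` through the scalar product of `L²`. -/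
def IsWeakTimeDeriv {N : ℕ} {Ω : Set (Vec N)} (T : ℝ) (u : ℝ → H10σ Ω) (u' : ℝ → Hneg1σ Ω) :
    Prop :=
  ∀ ψ : ℝ → ℝ, ContDiff ℝ ∞ ψ → HasCompactSupport ψ → tsupport ψ ⊆ Ioo 0 T → ∀ w : H10σ Ω,
    ∫ t in Ioo 0 T, ψ t * u' t w = - ∫ t in Ioo 0 T, deriv ψ t * inner ℝ (field (u t)) (field w)

/-- `u|_{t = 0} = u₀`: for every `w` the function `t ↦ (u(t), w)_{L²}` is a.e. equal to a
continuous function on `[0, T]` with the value `(u₀, w)_{L²}` at `0`. -/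
def HasInitialValue {N : ℕ} {Ω : Set (Vec N)} (T : ℝ) (u : ℝ → H10σ Ω) (u₀ : H10σ Ω) : Prop :=
  ∀ w : H10σ Ω, ∃ c : ℝ → ℝ, ContinuousOn c (Icc 0 T) ∧
    (∀ᵐ t ∂(timeMeasure T), inner ℝ (field (u t)) (field w) = c t) ∧
    c 0 = inner ℝ (field u₀) (field w)

/-- Weak solutions on `(0, T) × Ω` with initial value `u₀` and force `f`. The variational
inequality is asked for every test function `φ ∈ L²((0,T), H¹_{0,σ})`, and its time integrals are
to exist; for the three terms other than the two listed this is automatic. Elements of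
`H¹_{0,σ}(Ω)` lie in `L²_σ(Ω)`, so that only the bound in `L^∞((0,T), L²)` has to be required. -/
def IsWeakSolution {N : ℕ} {Ω : Set (Vec N)} (F : ℝ → ℝ) (T : ℝ) (u₀ : H10σ Ω)
    (f : ℝ → Hneg1σ Ω) (u : ℝ → H10σ Ω) : Prop :=
  MemLp u 2 (timeMeasure T) ∧
  MemLp (fun t => field (u t)) ∞ (timeMeasure T) ∧
  HasInitialValue T u u₀ ∧
  ∃ u' : ℝ → Hneg1σ Ω, MemLp u' (4 / (N : ℝ≥0∞)) (timeMeasure T) ∧ IsWeakTimeDeriv T u u' ∧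
    ∀ φ : ℝ → H10σ Ω, MemLp φ 2 (timeMeasure T) →
      Integrable (fun t => u' t (φ t - u t)) (timeMeasure T) ∧
      Integrable (fun t => convection (u t) (φ t)) (timeMeasure T) ∧
      (∫ t in Ioo 0 T, u' t (φ t - u t)) + (∫ t in Ioo 0 T, viscousForm (u t) (φ t - u t))
          - (∫ t in Ioo 0 T, convection (u t) (φ t)) + (∫ t in Ioo 0 T, (j F (φ t) - j F (u t)))
        ≥ ∫ t in Ioo 0 T, f t (φ t - u t)

end ShearThinning

end

open MeasureTheory Set
open scoped ENNReal ContDiff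

noncomputable section

namespace ShearThinning

/-! ### The spaces of pairs (field, gradient) and their continuous operators. -/

section

variable {N : ℕ} {Ω : Set (Vec N)}

/-! The variational inequality is tested with multiples of the solution. Along a ray `τ ↦ (1 + τ) v`
the functional `j` is differentiable at `τ = 0`, even if `D(v)` vanishes on a large set, because
there the integrand `G(|(1 + τ) D(v)|)` stays zero (`hasDerivAt_j_smul`). Take `φ = u + c 1_A u`
with `A` a measurable set of times. The convective term drops out (`convection_self`), and as `A` is
arbitrary, for almost every `t` the function `c a(t) + j((1 + c) u(t)) - j(u(t))` of `c ∈ ℝ`, where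
`a = ⟨u', u⟩ + ∫ |D(u)|² - ⟨f, u⟩`, is nonnegative. It vanishes at `c = 0`, hence so does its
derivative there: `a = -⟨j'(u), u⟩` (`ae_eq_neg_jDeriv`). So `η = 1` serves.

It remains to integrate in time. Korn's identity `viscousForm_self` turns `∫ |D(u)|²` into half of
`‖∇u‖²`, and the Lions–Magenes identity `ae_norm_sq_eq_of_weak_deriv` integrates `⟨u', u⟩`. The
latter needs `u'` in `L²`, while for `N = 3` the exponent in the definition is only `4/3`. But `⟨u',
φ⟩` is integrable for every `φ` in `L²`, and by uniform boundedness this forces `u'` into `L²`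
(`memLp_two_of_forall_integrable_apply`). -/

lemma jacobian_apply (φ : Vec N → Vec N) (x : Vec N) (i k : Fin N) :
    jacobian φ x (i, k) = fderiv ℝ φ x (EuclideanSpace.single k 1) i := rfl

lemma jacobian_add {φ ψ : Vec N → Vec N} (hφ : Differentiable ℝ φ) (hψ : Differentiable ℝ ψ)
    (x : Vec N) : jacobian (φ + ψ) x = jacobian φ x + jacobian ψ x := by
  ext p
  obtain ⟨i, k⟩ := p
  simp [jacobian_apply, fderiv_add (hφ x) (hψ x)]

lemma jacobian_const_smul {φ : Vec N → Vec N} (hφ : Differentiable ℝ φ) (c : ℝ)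
    (x : Vec N) : jacobian (c • φ) x = c • jacobian φ x := by
  ext p
  obtain ⟨i, k⟩ := p
  simp [jacobian_apply, fderiv_const_smul (hφ x) c]

/-- The pairs `(φ, ∇ φ)` with `φ ∈ C_c^∞(Ω)^N`. -/
def smoothPairs (Ω : Set (Vec N)) : Submodule ℝ (GraphSpace Ω) where
  carrier := {p : GraphSpace Ω | ∃ φ : Vec N → Vec N,
    ContDiff ℝ ∞ φ ∧ HasCompactSupport φ ∧ tsupport φ ⊆ Ω ∧
    p.fst =ᵐ[volume.restrict Ω] φ ∧
    p.snd =ᵐ[volume.restrict Ω] jacobian φ}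
  zero_mem' := by
    refine ⟨0, contDiff_const, HasCompactSupport.zero, by simp, ?_, ?_⟩
    · exact Lp.coeFn_zero _ _ _
    · filter_upwards [Lp.coeFn_zero (Mat N) 2 (volume.restrict Ω)] with x hx
      have h : ((0 : GraphSpace Ω).snd : Vec N → Mat N) x = 0 := hx
      rw [h]
      ext p
      simp [jacobian]
  add_mem' := by
    rintro p q ⟨φ, h1, h2, h3, h4, h5⟩ ⟨ψ, k1, k2, k3, k4, k5⟩
    refine ⟨φ + ψ, h1.add k1, h2.add k2, ?_, ?_, ?_⟩
    · exact (tsupport_add φ ψ).trans (union_subset h3 k3)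
    · filter_upwards [h4, k4, Lp.coeFn_add p.fst q.fst] with x a b c
      have h : ((p + q).fst : Vec N → Vec N) x = p.fst x + q.fst x := c
      rw [h, a, b]; rfl
    · filter_upwards [h5, k5, Lp.coeFn_add p.snd q.snd] with x a b c
      have h : ((p + q).snd : Vec N → Mat N) x = p.snd x + q.snd x := c
      rw [h, a, b, jacobian_add (h1.differentiable (by simp)) (k1.differentiable (by simp))]
  smul_mem' := by
    rintro c p ⟨φ, h1, h2, h3, h4, h5⟩
    refine ⟨c • φ, contDiff_const.smul h1, h2.smul_left (f := fun _ => c), ?_, ?_, ?_⟩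
    · exact (closure_mono (Function.support_const_smul_subset c φ)).trans h3
    · filter_upwards [h4, Lp.coeFn_smul c p.fst] with x a b
      have h : ((c • p).fst : Vec N → Vec N) x = c • p.fst x := b
      rw [h, a]; rfl
    · filter_upwards [h5, Lp.coeFn_smul c p.snd] with x a b
      have h : ((c • p).snd : Vec N → Mat N) x = c • p.snd x := b
      rw [h, a, jacobian_const_smul (h1.differentiable (by simp))]

/-- The test pairs already form a subspace, so taking the span adds nothing, and density arguments
may use a single test field instead of a linear combination. -/
lemma H10_eq_closure : H10 Ω = (smoothPairs Ω).topologicalClosure := by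
  unfold H10
  congr 1
  exact Submodule.span_eq (smoothPairs Ω)

/-- The field component, as a continuous linear map on pairs. -/
def fstL (Ω : Set (Vec N)) : GraphSpace Ω →L[ℝ] Lp (Vec N) 2 (volume.restrict Ω) :=
  WithLp.fstL 2 ℝ _ _

/-- The gradient component, as a continuous linear map on pairs. -/
def sndL (Ω : Set (Vec N)) : GraphSpace Ω →L[ℝ] Lp (Mat N) 2 (volume.restrict Ω) :=
  WithLp.sndL 2 ℝ _ _

lemma H10_induction {P : GraphSpace Ω → Prop} (hP : IsClosed {p | P p})
    (h : ∀ p ∈ smoothPairs Ω, P p) {p : GraphSpace Ω} (hp : p ∈ H10 Ω) : P p := by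
  rw [H10_eq_closure] at hp
  have : closure (smoothPairs Ω : Set (GraphSpace Ω)) ⊆ {p | P p} := closure_minimal h hP
  exact this hp

/-- The trace of a matrix. -/
def traceL (N : ℕ) : Mat N →L[ℝ] ℝ := ∑ i : Fin N, EuclideanSpace.proj (i, i)

lemma traceL_apply (A : Mat N) : traceL N A = ∑ i : Fin N, A (i, i) := by
  simp [traceL]

/-- The transpose of a matrix. -/
def transposeL (N : ℕ) : Mat N →L[ℝ] Mat N :=
  (LinearIsometryEquiv.piLpCongrLeft 2 ℝ ℝ (Equiv.prodComm (Fin N) (Fin N))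
    ).toContinuousLinearEquiv.toContinuousLinearMap

lemma transposeL_apply (A : Mat N) (p : Fin N × Fin N) : transposeL N A p = A p.swap := by
  simp [transposeL, Equiv.piCongrLeft']

/-- The symmetric part of a matrix, as a continuous linear map. -/
def symPartL (N : ℕ) : Mat N →L[ℝ] Mat N :=
  (1 / 2 : ℝ) • (ContinuousLinearMap.id ℝ (Mat N) + transposeL N)

lemma symPartL_apply (A : Mat N) : symPartL N A = symPart A := by
  ext p
  simp [symPartL, symPart, transposeL_apply]
  ring

/-- The divergence, from the gradient component. -/
def divL (Ω : Set (Vec N)) : GraphSpace Ω →L[ℝ] Lp ℝ 2 (volume.restrict Ω) :=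
  ((traceL N).compLpL 2 (volume.restrict Ω)).comp (sndL Ω)

lemma coeFn_divL (p : GraphSpace Ω) :
    divL Ω p =ᵐ[volume.restrict Ω] fun x => ∑ i : Fin N, p.snd x (i, i) := by
  filter_upwards [(traceL N).coeFn_compLpL (p := 2) (μ := volume.restrict Ω) p.snd] with x hx
  rw [← traceL_apply]
  exact hx

lemma mem_H10σ_iff {p : GraphSpace Ω} : p ∈ H10σ Ω ↔ p ∈ H10 Ω ∧ divL Ω p = 0 := by
  rw [Lp.eq_zero_iff_ae_eq_zero]
  constructor
  · rintro ⟨h1, h2⟩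
    refine ⟨h1, ?_⟩
    filter_upwards [h2, coeFn_divL p] with x a b
    rw [b, a]; rfl
  · rintro ⟨h1, h2⟩
    refine ⟨h1, ?_⟩
    filter_upwards [h2, coeFn_divL p] with x a b
    rw [← b, a]; rfl

lemma isClosed_H10σ : IsClosed (H10σ Ω : Set (GraphSpace Ω)) := by
  have : (H10σ Ω : Set (GraphSpace Ω)) = (H10 Ω : Set (GraphSpace Ω)) ∩ divL Ω ⁻¹' {0} := by
    ext p
    exact mem_H10σ_iff
  rw [this]
  exact (Submodule.isClosed_topologicalClosure _).inter (isClosed_singleton.preimage (divL Ω).cont)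

instance : CompleteSpace (H10σ Ω) := isClosed_H10σ.completeSpace_coe

/-- Separability is what allows one null set of times to serve for all `w` in the energy identity.
-/
instance : SecondCountableTopology (H10σ Ω) := by
  have : Fact ((2 : ℝ≥0∞) ≠ ⊤) := ⟨by simp⟩
  have h1 : SecondCountableTopology (Lp (Vec N) 2 (volume.restrict Ω)) := inferInstance
  have h2 : SecondCountableTopology (Lp (Mat N) 2 (volume.restrict Ω)) := inferInstance
  have h3 : SecondCountableTopology (GraphSpace Ω) := WithLp.secondCountableTopology 2 _ _
  exact TopologicalSpace.Subtype.secondCountableTopology (H10σ Ω : Set (GraphSpace Ω))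

/-- `field` as a continuous linear map. -/
def fieldL (Ω : Set (Vec N)) : H10σ Ω →L[ℝ] Lp (Vec N) 2 (volume.restrict Ω) :=
  (fstL Ω).comp (H10σ Ω).subtypeL

/-- `grad` as a continuous linear map. -/
def gradL (Ω : Set (Vec N)) : H10σ Ω →L[ℝ] Lp (Mat N) 2 (volume.restrict Ω) :=
  (sndL Ω).comp (H10σ Ω).subtypeL

lemma fieldL_apply (v : H10σ Ω) : fieldL Ω v = field v := rfl

lemma gradL_apply (v : H10σ Ω) : gradL Ω v = grad v := rfl

/-- `symGrad` as a continuous linear map into `L²`. -/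
def symGradL (Ω : Set (Vec N)) : H10σ Ω →L[ℝ] Lp (Mat N) 2 (volume.restrict Ω) :=
  ((symPartL N).compLpL 2 (volume.restrict Ω)).comp (gradL Ω)

lemma coeFn_symGradL (v : H10σ Ω) : symGradL Ω v =ᵐ[volume.restrict Ω] symGrad v := by
  filter_upwards [(symPartL N).coeFn_compLpL (p := 2) (μ := volume.restrict Ω) (grad v)] with x hx
  rw [symGrad, ← symPartL_apply]
  exact hx

lemma viscousForm_eq_inner (v w : H10σ Ω) :
    viscousForm v w = inner ℝ (symGradL Ω v) (symGradL Ω w) := by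
  rw [L2.inner_def, viscousForm]
  refine integral_congr_ae ?_
  filter_upwards [coeFn_symGradL v, coeFn_symGradL w] with x a b
  rw [a, b]

end


/-! ### Korn's identity for divergence free fields. -/

section

variable {N : ℕ} {Ω : Set (Vec N)}

section Smooth

variable {E : Type*} [NormedAddCommGroup E] [NormedSpace ℝ E]

lemma contDiff_fderiv_apply_const {g : E → ℝ} (hg : ContDiff ℝ ∞ g) (w : E) :
    ContDiff ℝ ∞ fun x => fderiv ℝ g x w :=
  (hg.fderiv_right (m := ∞) (by simp)).clm_apply contDiff_const

lemma fderiv_fderiv_apply_comm {g : E → ℝ} (hg : ContDiff ℝ ∞ g) (v w x : E) :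
    fderiv ℝ (fun y => fderiv ℝ g y w) x v = fderiv ℝ (fun y => fderiv ℝ g y v) x w := by
  have hd : Differentiable ℝ (fderiv ℝ g) :=
    (hg.fderiv_right (m := ∞) (by simp)).differentiable (by simp)
  have h : ∀ a b : E, fderiv ℝ (fun y => fderiv ℝ g y a) x b = fderiv ℝ (fderiv ℝ g) x b a := by
    intro a b
    rw [fderiv_clm_apply (hd x) (differentiableAt_const a)]
    simp
  rw [h, h]
  exact second_derivative_symmetric (f := g) (f' := fderiv ℝ g)
    (fun y => (hg.differentiable (by simp) y).hasFDerivAt) (hd x).hasFDerivAt v w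

variable [FiniteDimensional ℝ E] [MeasurableSpace E] [BorelSpace E]
  (μ : Measure E) [μ.IsAddHaarMeasure]

lemma integral_fderiv_mul_eq_neg {f g : E → ℝ} (hf : ContDiff ℝ ∞ f) (hg : ContDiff ℝ ∞ g)
    (hfc : HasCompactSupport f) (v : E) :
    ∫ x, fderiv ℝ f x v * g x ∂μ = - ∫ x, f x * fderiv ℝ g x v ∂μ := by
  have c1 := (contDiff_fderiv_apply_const hf v).continuous
  have c2 := (contDiff_fderiv_apply_const hg v).continuous
  have h1 : HasCompactSupport fun x => fderiv ℝ f x v := hfc.fderiv_apply (𝕜 := ℝ) v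
  rw [integral_mul_fderiv_eq_neg_fderiv_mul_of_integrable, neg_neg]
  · exact (c1.mul hg.continuous).integrable_of_hasCompactSupport (h1.mul_right)
  · exact (hf.continuous.mul c2).integrable_of_hasCompactSupport (hfc.mul_right)
  · exact (hf.continuous.mul hg.continuous).integrable_of_hasCompactSupport (hfc.mul_right)
  · exact fun x _ => hf.differentiable (by simp) x
  · exact fun x _ => hg.differentiable (by simp) x

/-- Integration by parts puts both derivatives on `g`, where they commute. -/
lemma integral_fderiv_mul_fderiv_comm {f g : E → ℝ} (hf : ContDiff ℝ ∞ f) (hg : ContDiff ℝ ∞ g)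
    (hfc : HasCompactSupport f) (v w : E) :
    ∫ x, fderiv ℝ f x v * fderiv ℝ g x w ∂μ = ∫ x, fderiv ℝ f x w * fderiv ℝ g x v ∂μ := by
  rw [integral_fderiv_mul_eq_neg μ hf (contDiff_fderiv_apply_const hg w) hfc,
    integral_fderiv_mul_eq_neg μ hf (contDiff_fderiv_apply_const hg v) hfc]
  congr 2
  ext x
  rw [fderiv_fderiv_apply_comm hg]

end Smooth

lemma contDiff_component {φ : Vec N → Vec N} (hφ : ContDiff ℝ ∞ φ) (i : Fin N) :
    ContDiff ℝ ∞ fun x => φ x i :=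
  (EuclideanSpace.proj i : Vec N →L[ℝ] ℝ).contDiff.comp hφ

lemma hasCompactSupport_component {φ : Vec N → Vec N} (hφ : HasCompactSupport φ) (i : Fin N) :
    HasCompactSupport fun x => φ x i :=
  hφ.comp_left (g := fun y : Vec N => y i) rfl

lemma jacobian_eq_fderiv_component {φ : Vec N → Vec N} (hφ : ContDiff ℝ ∞ φ) (x : Vec N)
    (i k : Fin N) :
    jacobian φ x (i, k) = fderiv ℝ (fun y => φ y i) x (EuclideanSpace.single k 1) := by
  have h := ((EuclideanSpace.proj i : Vec N →L[ℝ] ℝ).hasFDerivAt.comp x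
    (hφ.differentiable (by simp) x).hasFDerivAt).fderiv
  have h' : fderiv ℝ (fun y => φ y i) x =
    (EuclideanSpace.proj i : Vec N →L[ℝ] ℝ).comp (fderiv ℝ φ x) := h
  rw [h']
  rfl

lemma jacobian_eq_zero_of_notMem {φ : Vec N → Vec N} {x : Vec N} (hx : x ∉ tsupport φ) :
    jacobian φ x = 0 := by
  ext p
  obtain ⟨i, k⟩ := p
  rw [jacobian_apply, image_eq_zero_of_notMem_tsupport (fun h => hx (tsupport_fderiv_subset ℝ h))]
  rfl

lemma continuous_jacobian_apply {φ : Vec N → Vec N} (hφ : ContDiff ℝ ∞ φ) (i k : Fin N) :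
    Continuous fun x => jacobian φ x (i, k) := by
  simp only [jacobian_eq_fderiv_component hφ]
  exact (contDiff_fderiv_apply_const (contDiff_component hφ i) _).continuous

/-- For test fields `∫ ∇φ : ∇φᵀ = ∫ (div φ)²`. -/
lemma integral_jacobian_transpose {φ : Vec N → Vec N} (hφ : ContDiff ℝ ∞ φ)
    (hc : HasCompactSupport φ) :
    ∫ x, ∑ i, ∑ k, jacobian φ x (i, k) * jacobian φ x (k, i) =
      ∫ x, ∑ i, ∑ k, jacobian φ x (i, i) * jacobian φ x (k, k) := by
  have hint : ∀ a b c d : Fin N,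
      Integrable (fun x => jacobian φ x (a, b) * jacobian φ x (c, d)) volume := by
    intro a b c d
    refine ((continuous_jacobian_apply hφ a b).mul
      (continuous_jacobian_apply hφ c d)).integrable_of_hasCompactSupport ?_
    refine HasCompactSupport.intro hc fun x hx => ?_
    simp [jacobian_eq_zero_of_notMem hx]
  rw [integral_finsetSum _ fun i _ => integrable_finsetSum _ fun k _ => hint i k k i,
    integral_finsetSum _ fun i _ => integrable_finsetSum _ fun k _ => hint i i k k]
  refine Finset.sum_congr rfl fun i _ => ?_
  rw [integral_finsetSum _ fun k _ => hint i k k i, integral_finsetSum _ fun k _ => hint i i k k]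
  refine Finset.sum_congr rfl fun k _ => ?_
  simp only [jacobian_eq_fderiv_component hφ]
  exact integral_fderiv_mul_fderiv_comm volume (contDiff_component hφ i) (contDiff_component hφ k)
    (hasCompactSupport_component hc i) _ _

lemma setIntegral_eq_of_tsupport_subset {φ : Vec N → Vec N} (hs : tsupport φ ⊆ Ω)
    {g : Vec N → ℝ} (hg : ∀ x ∉ tsupport φ, g x = 0) : ∫ x in Ω, g x = ∫ x, g x :=
  setIntegral_eq_integral_of_forall_compl_eq_zero fun x hx => hg x fun h => hx (hs h)

/-- Both sides are continuous in the gradient, so `integral_jacobian_transpose` passes to the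
closure. For divergence free fields it kills the cross term of `|∇v + ∇vᵀ|²`. -/
lemma inner_transpose_eq_of_mem_H10 {p : GraphSpace Ω} (hp : p ∈ H10 Ω) :
    inner ℝ (sndL Ω p) ((transposeL N).compLpL 2 (volume.restrict Ω) (sndL Ω p)) =
      inner ℝ (divL Ω p) (divL Ω p) := by
  refine H10_induction (P := fun p => inner ℝ (sndL Ω p)
    ((transposeL N).compLpL 2 (volume.restrict Ω) (sndL Ω p)) =
      inner ℝ (divL Ω p) (divL Ω p)) ?_ ?_ hp
  · exact isClosed_eq (by fun_prop) (by fun_prop)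
  · rintro p ⟨φ, h1, h2, h3, -, h5⟩
    rw [L2.inner_def, L2.inner_def]
    have e1 : ∀ᵐ x ∂(volume.restrict Ω), inner ℝ ((sndL Ω p) x)
        ((transposeL N).compLpL 2 (volume.restrict Ω) (sndL Ω p) x) =
        ∑ i, ∑ k, jacobian φ x (i, k) * jacobian φ x (k, i) := by
      filter_upwards [h5, (transposeL N).coeFn_compLpL (p := 2) (μ := volume.restrict Ω) p.snd]
        with x a b
      have a' : (sndL Ω p) x = jacobian φ x := a
      have b' : (transposeL N).compLpL 2 (volume.restrict Ω) (sndL Ω p) x =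
        transposeL N (p.snd x) := b
      rw [a', b', a, PiLp.inner_apply, Fintype.sum_prod_type]
      simp [transposeL_apply, mul_comm]
    have e2 : ∀ᵐ x ∂(volume.restrict Ω), inner ℝ ((divL Ω p) x) ((divL Ω p) x) =
        ∑ i, ∑ k, jacobian φ x (i, i) * jacobian φ x (k, k) := by
      filter_upwards [h5, coeFn_divL p] with x a b
      rw [b, a, ← Finset.sum_mul_sum]
      simp [sq]
    rw [integral_congr_ae e1, integral_congr_ae e2,
      setIntegral_eq_of_tsupport_subset h3, setIntegral_eq_of_tsupport_subset h3,
      integral_jacobian_transpose h1 h2]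
    all_goals
      intro x hx
      simp [jacobian_eq_zero_of_notMem hx]

/-- Korn's identity for divergence free fields. -/
lemma viscousForm_self (v : H10σ Ω) : viscousForm v v = 1 / 2 * ‖grad v‖ ^ 2 := by
  obtain ⟨h1, h2⟩ := mem_H10σ_iff.1 v.2
  have h3 := inner_transpose_eq_of_mem_H10 h1
  rw [h2, inner_zero_left] at h3
  have h4 : symGradL Ω v = (1 / 2 : ℝ) • (sndL Ω v +
      (transposeL N).compLpL 2 (volume.restrict Ω) (sndL Ω v)) := by
    ext1
    filter_upwards [coeFn_symGradL v, Lp.coeFn_smul (1 / 2 : ℝ) (sndL Ω v +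
      (transposeL N).compLpL 2 (volume.restrict Ω) (sndL Ω v)), Lp.coeFn_add (sndL Ω v)
      ((transposeL N).compLpL 2 (volume.restrict Ω) (sndL Ω v)),
      (transposeL N).coeFn_compLpL (p := 2) (μ := volume.restrict Ω) (sndL Ω v)] with x a b c d
    rw [a, b, Pi.smul_apply, c, Pi.add_apply, d, symGrad, ← symPartL_apply]
    rfl
  have h5 : ‖(transposeL N).compLpL 2 (volume.restrict Ω) (sndL Ω v)‖ = ‖sndL Ω v‖ := by
    have : ∀ q, ‖(transposeL N).compLpL 2 (volume.restrict Ω) q‖ = ‖q‖ := by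
      intro q
      rw [Lp.norm_def, Lp.norm_def]
      congr 1
      refine eLpNorm_congr_norm_ae ?_
      filter_upwards [(transposeL N).coeFn_compLpL (p := 2) (μ := volume.restrict Ω) q] with x hx
      rw [hx]
      exact (LinearIsometryEquiv.piLpCongrLeft 2 ℝ ℝ (Equiv.prodComm (Fin N) (Fin N))).norm_map _
    exact this _
  -- Expand `‖(A + Aᵀ) / 2‖²`: the cross term is zero by `h3` and `‖Aᵀ‖ = ‖A‖` by `h5`, which leaves
  -- `‖A‖² / 2`.
  rw [viscousForm_eq_inner, h4, real_inner_self_eq_norm_sq, norm_smul, mul_pow, norm_add_sq_real,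
    h3, h5, ← gradL_apply]
  have : sndL Ω (v : GraphSpace Ω) = gradL Ω v := rfl
  rw [this]
  norm_num
  ring

end


/-! ### The embedding of `H¹₀` in `L⁴` and tensor products. -/

section

variable {N : ℕ} {Ω : Set (Vec N)}

/-- Cauchy–Schwarz in each row. The Sobolev inequality used below is stated with the operator norm
of the derivative, the spaces here with the Frobenius norm. -/
lemma norm_fderiv_le_norm_jacobian (φ : Vec N → Vec N) (x : Vec N) :
    ‖fderiv ℝ φ x‖ ≤ ‖jacobian φ x‖ := by
  refine ContinuousLinearMap.opNorm_le_bound _ (norm_nonneg _) fun y => ?_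
  have hy : ∀ i, fderiv ℝ φ x y i = ∑ k, jacobian φ x (i, k) * y k := by
    intro i
    have h : y = ∑ k, y k • EuclideanSpace.single k (1 : ℝ) := by
      ext m
      simp [Finset.sum_apply, Pi.single_apply]
    conv_lhs => rw [h]
    simp [jacobian_apply, mul_comm]
  refine abs_le_of_sq_le_sq' ?_ (by positivity) |>.2
  rw [mul_pow, EuclideanSpace.norm_sq_eq, EuclideanSpace.norm_sq_eq, EuclideanSpace.norm_sq_eq,
    Fintype.sum_prod_type, Finset.sum_mul]
  refine Finset.sum_le_sum fun i _ => ?_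
  simp only [Real.norm_eq_abs, sq_abs, hy]
  exact Finset.sum_mul_sq_le_sq_mul_sq _ _ _

/-- Sobolev's inequality for test fields in dimension two and three. -/
lemma exists_eLpNorm_four_le_of_smooth (hN : N = 2 ∨ N = 3) (hΩ : Bornology.IsBounded Ω) :
    ∃ C : NNReal, ∀ φ : Vec N → Vec N, ContDiff ℝ ∞ φ → tsupport φ ⊆ Ω →
      eLpNorm φ 4 (volume.restrict Ω) ≤ C * eLpNorm (jacobian φ) 2 (volume.restrict Ω) := by
  -- Both witnesses solve `1/p - 1/N = 1/4`. The choice `p = 2` is impossible for `N = 2`, since `p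
  -- < N` is needed; Hölder on the bounded set returns from `L^p` to `L²`.
  obtain ⟨p, hp1, hpN, hp2, hpq⟩ : ∃ p : NNReal, 1 ≤ p ∧ p < N ∧ p ≤ 2 ∧
      (p : ℝ)⁻¹ - (N : ℝ)⁻¹ ≤ (4 : ℝ)⁻¹ := by
    rcases hN with rfl | rfl
    · refine ⟨4 / 3, ?_, ?_, ?_, by norm_num⟩
      · rw [← NNReal.coe_le_coe]; norm_num
      · rw [← NNReal.coe_lt_coe]; norm_num
      · rw [← NNReal.coe_le_coe]; norm_num
    · refine ⟨12 / 7, ?_, ?_, ?_, by norm_num⟩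
      · rw [← NNReal.coe_le_coe]; norm_num
      · rw [← NNReal.coe_lt_coe]; norm_num
      · rw [← NNReal.coe_le_coe]; norm_num
  have hμ : volume Ω ≠ ⊤ := hΩ.measure_lt_top.ne
  have : IsFiniteMeasure (volume.restrict Ω) := ⟨by simpa using hΩ.measure_lt_top⟩
  refine ⟨eLpNormLESNormFDerivOfLeConst (Vec N) (volume : Measure (Vec N)) Ω p 4 *
    ((volume Ω) ^ (1 / (p : ℝ≥0∞).toReal - 1 / (2 : ℝ≥0∞).toReal)).toNNReal, ?_⟩
  intro φ hφ hs
  have hexp : 0 ≤ 1 / (p : ℝ≥0∞).toReal - 1 / (2 : ℝ≥0∞).toReal := by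
    have h1 : (p : ℝ) ≤ 2 := by exact_mod_cast hp2
    have h2 : (0 : ℝ) < p := lt_of_lt_of_le one_pos (by exact_mod_cast hp1)
    simpa using inv_anti₀ h2 h1
  have hsφ : Function.support φ ⊆ Ω := (subset_tsupport φ).trans hs
  have hsf : Function.support (fderiv ℝ φ) ⊆ Ω := (support_fderiv_subset ℝ).trans hs
  have h1 := eLpNorm_le_eLpNorm_fderiv_of_le (volume : Measure (Vec N)) (u := φ) (s := Ω)
    (p := p) (q := 4) (hφ.of_le (by simp)) hsφ hp1 (by simpa using hpN) (by simpa using hpq) hΩ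
  rw [ENNReal.coe_mul, ENNReal.coe_toNNReal (ENNReal.rpow_ne_top_of_nonneg hexp hμ)]
  calc eLpNorm φ 4 (volume.restrict Ω) = eLpNorm φ ((4 : NNReal) : ℝ≥0∞) volume := by
        rw [eLpNorm_restrict_eq_of_support_subset hsφ]; rfl
    _ ≤ _ := h1
    _ = eLpNormLESNormFDerivOfLeConst (Vec N) (volume : Measure (Vec N)) Ω p 4 *
          eLpNorm (fderiv ℝ φ) p (volume.restrict Ω) := by
        congr 1
        exact (eLpNorm_restrict_eq_of_support_subset hsf).symm
    _ ≤ eLpNormLESNormFDerivOfLeConst (Vec N) (volume : Measure (Vec N)) Ω p 4 *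
          (eLpNorm (fderiv ℝ φ) 2 (volume.restrict Ω) *
            (volume Ω) ^ (1 / (p : ℝ≥0∞).toReal - 1 / (2 : ℝ≥0∞).toReal)) := by
        gcongr
        have := eLpNorm_le_eLpNorm_mul_rpow_measure_univ (μ := volume.restrict Ω)
          (f := fderiv ℝ φ) (p := p) (q := 2) (by exact_mod_cast hp2)
          (hφ.continuous_fderiv (by simp)).aestronglyMeasurable
        simpa using this
    _ ≤ eLpNormLESNormFDerivOfLeConst (Vec N) (volume : Measure (Vec N)) Ω p 4 *
          (eLpNorm (jacobian φ) 2 (volume.restrict Ω) *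
            (volume Ω) ^ (1 / (p : ℝ≥0∞).toReal - 1 / (2 : ℝ≥0∞).toReal)) := by
        gcongr
        exact eLpNorm_mono fun x => norm_fderiv_le_norm_jacobian φ x
    _ = _ := by ring

/-- The embedding `H¹₀ ⊆ L⁴` in dimension two and three. -/
lemma exists_eLpNorm_four_le (hN : N = 2 ∨ N = 3) (hΩ : Bornology.IsBounded Ω) :
    ∃ C : NNReal, ∀ p ∈ H10 Ω, eLpNorm p.fst 4 (volume.restrict Ω) ≤ C * ‖sndL Ω p‖ₑ := by
  obtain ⟨C, hC⟩ := exists_eLpNorm_four_le_of_smooth hN hΩ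
  refine ⟨C, fun p hp => H10_induction
    (P := fun p => eLpNorm p.fst 4 (volume.restrict Ω) ≤ C * ‖sndL Ω p‖ₑ) ?_ ?_ hp⟩
  -- Continuity into `L⁴` is not available yet. Closedness comes from lower semicontinuity of the
  -- `L⁴` norm under convergence in measure, which `L²` convergence provides.
  · refine IsSeqClosed.isClosed fun q q₀ hq hlim => ?_
    refine ENNReal.le_of_forall_pos_le_add fun ε hε _ => ?_
    have h1 : Filter.Tendsto (fun n => (C : ℝ≥0∞) * ‖sndL Ω (q n)‖ₑ) Filter.atTop
        (nhds (C * ‖sndL Ω q₀‖ₑ)) :=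
      ENNReal.Tendsto.const_mul (((sndL Ω).continuous.enorm.tendsto q₀).comp hlim)
        (Or.inr ENNReal.coe_ne_top)
    have h2 : Filter.Tendsto (fun n => fstL Ω (q n)) Filter.atTop (nhds (fstL Ω q₀)) :=
      ((fstL Ω).continuous.tendsto q₀).comp hlim
    refine eLpNorm_le_of_tendstoInMeasure (u := Filter.atTop) (f := fun n => fstL Ω (q n)) ?_
      (tendstoInMeasure_of_tendsto_Lp h2) (fun n => Lp.aestronglyMeasurable _)
    have h3 : C * ‖sndL Ω q₀‖ₑ < C * ‖sndL Ω q₀‖ₑ + ε :=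
      ENNReal.lt_add_right (by finiteness) (by simpa using hε.ne')
    filter_upwards [h1.eventually_lt_const h3] with n hn
    exact (hq n).trans hn.le
  · rintro p ⟨φ, h1, h2, h3, h4, h5⟩
    rw [Lp.enorm_def, eLpNorm_congr_ae h4]
    have h6 : sndL Ω p =ᵐ[volume.restrict Ω] jacobian φ := h5
    rw [eLpNorm_congr_ae h6]
    exact hC φ h1 h3

/-- The tensor product `(a ⊗ b)_{ik} = a_i b_k`. -/
def tensor (a b : Vec N) : Mat N := WithLp.toLp 2 fun p => a p.1 * b p.2

lemma norm_tensor (a b : Vec N) : ‖tensor a b‖ = ‖a‖ * ‖b‖ := by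
  refine (sq_eq_sq₀ (norm_nonneg _) (by positivity)).1 ?_
  rw [mul_pow, EuclideanSpace.norm_sq_eq, EuclideanSpace.norm_sq_eq, EuclideanSpace.norm_sq_eq,
    Fintype.sum_prod_type, Finset.sum_mul_sum]
  simp [tensor, mul_pow]

lemma continuous_tensor : Continuous fun q : Vec N × Vec N => tensor q.1 q.2 :=
  (PiLp.continuous_toLp 2 _).comp (continuous_pi fun p => by fun_prop)

/-- Writes the convective integrand as `∇v : (w ⊗ v)`, a gradient in `L²` against a product of two
fields in `L⁴`. -/
lemma inner_tensor (A : Mat N) (a b : Vec N) :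
    inner ℝ A (tensor a b) = ∑ i, (∑ k, b k * A (i, k)) * a i := by
  rw [PiLp.inner_apply, Fintype.sum_prod_type]
  refine Finset.sum_congr rfl fun i _ => ?_
  rw [Finset.sum_mul]
  refine Finset.sum_congr rfl fun k _ => ?_
  simp [tensor]
  ring

instance : ENNReal.HolderTriple 4 4 2 := ⟨by
  rw [← two_mul, ← ENNReal.toReal_eq_toReal_iff' (by finiteness) (by simp), ENNReal.toReal_mul]
  norm_num⟩

lemma eLpNorm_tensor_le {μ : Measure (Vec N)} {a b : Vec N → Vec N}
    (ha : AEStronglyMeasurable a μ) (hb : AEStronglyMeasurable b μ) :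
    eLpNorm (fun x => tensor (a x) (b x)) 2 μ ≤ eLpNorm a 4 μ * eLpNorm b 4 μ := by
  have := eLpNorm_le_eLpNorm_mul_eLpNorm'_of_norm (p := 4) (q := 4) (r := 2) ha hb tensor 1
    (Filter.Eventually.of_forall fun x => by simp [norm_tensor])
  simpa using this

end


/-! ### Vanishing of the convective term. -/

section

variable {N : ℕ} {Ω : Set (Vec N)}

/-- The gradient of a scalar function, as a vector field. -/
def gradVec (ψ : Vec N → ℝ) (x : Vec N) : Vec N :=
  WithLp.toLp 2 fun k => fderiv ℝ ψ x (EuclideanSpace.single k 1)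

lemma continuous_gradVec {ψ : Vec N → ℝ} (hψ : ContDiff ℝ ∞ ψ) : Continuous (gradVec ψ) :=
  (PiLp.continuous_toLp 2 _).comp (continuous_pi fun _ =>
    (contDiff_fderiv_apply_const hψ _).continuous)

lemma hasCompactSupport_gradVec {ψ : Vec N → ℝ} (hψ : HasCompactSupport ψ) :
    HasCompactSupport (gradVec ψ) := by
  refine HasCompactSupport.intro hψ fun x hx => ?_
  ext k
  simp [gradVec, image_eq_zero_of_notMem_tsupport fun h => hx (tsupport_fderiv_subset ℝ h)]

/-- The divergence theorem `∫ v · ∇ψ = - ∫ ψ div v` on `H¹₀`. -/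
lemma integral_inner_gradVec {ψ : Vec N → ℝ} (hψ : ContDiff ℝ ∞ ψ) (hc : HasCompactSupport ψ)
    {p : GraphSpace Ω} (hp : p ∈ H10 Ω) :
    ∫ x in Ω, inner ℝ (p.fst x) (gradVec ψ x) = - ∫ x in Ω, divL Ω p x * ψ x := by
  have m1 : MemLp (gradVec ψ) 2 (volume.restrict Ω) :=
    (continuous_gradVec hψ).memLp_of_hasCompactSupport (hasCompactSupport_gradVec hc)
  have m2 : MemLp ψ 2 (volume.restrict Ω) := hψ.continuous.memLp_of_hasCompactSupport hc
  have key : inner ℝ (fstL Ω p) (m1.toLp _) = - inner ℝ (divL Ω p) (m2.toLp _) := by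
    refine H10_induction (P := fun p => inner ℝ (fstL Ω p) (m1.toLp _) =
      - inner ℝ (divL Ω p) (m2.toLp _)) ?_ ?_ hp
    · exact isClosed_eq (by fun_prop) (by fun_prop)
    · rintro p ⟨φ, h1, h2, h3, h4, h5⟩
      rw [L2.inner_def, L2.inner_def]
      have e1 : ∀ᵐ x ∂(volume.restrict Ω), inner ℝ (fstL Ω p x) (m1.toLp _ x) =
          ∑ k, φ x k * fderiv ℝ ψ x (EuclideanSpace.single k 1) := by
        filter_upwards [h4, m1.coeFn_toLp] with x a b
        have a' : fstL Ω p x = φ x := a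
        rw [a', b, PiLp.inner_apply]
        simp [gradVec, mul_comm]
      have e2 : ∀ᵐ x ∂(volume.restrict Ω), inner ℝ (divL Ω p x) (m2.toLp _ x) =
          ∑ k, jacobian φ x (k, k) * ψ x := by
        filter_upwards [h5, coeFn_divL p, m2.coeFn_toLp] with x a b c
        rw [b, c, a, ← Finset.sum_mul]
        simp [mul_comm]
      rw [integral_congr_ae e1, integral_congr_ae e2,
        setIntegral_eq_of_tsupport_subset h3, setIntegral_eq_of_tsupport_subset h3]
      rotate_left
      · intro x hx
        simp [jacobian_eq_zero_of_notMem hx]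
      · intro x hx
        simp [image_eq_zero_of_notMem_tsupport hx]
      rw [integral_finsetSum, integral_finsetSum, ← Finset.sum_neg_distrib]
      rotate_left
      · intro k _
        exact ((continuous_jacobian_apply h1 k k).mul hψ.continuous).integrable_of_hasCompactSupport
          hc.mul_left
      · intro k _
        exact ((contDiff_component h1 k).continuous.mul
          (contDiff_fderiv_apply_const hψ _).continuous).integrable_of_hasCompactSupport
          (hasCompactSupport_component h2 k).mul_right
      refine Finset.sum_congr rfl fun k _ => ?_
      simp only [jacobian_eq_fderiv_component h1]
      rw [integral_fderiv_mul_eq_neg volume (contDiff_component h1 k) hψ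
        (hasCompactSupport_component h2 k), neg_neg]
  rw [L2.inner_def, L2.inner_def] at key
  have e1 : ∫ x in Ω, inner ℝ (fstL Ω p x) (m1.toLp _ x) =
      ∫ x in Ω, inner ℝ (p.fst x) (gradVec ψ x) := by
    refine integral_congr_ae ?_
    filter_upwards [m1.coeFn_toLp] with x a
    rw [a]; rfl
  have e2 : ∫ x in Ω, inner ℝ (divL Ω p x) (m2.toLp _ x) = ∫ x in Ω, divL Ω p x * ψ x := by
    refine integral_congr_ae ?_
    filter_upwards [m2.coeFn_toLp] with x a
    rw [a]
    simp [mul_comm]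
  rw [← e1, ← e2, key]

/-- `∫ (v · ∇φ) · φ = 0` for divergence free `v` and test fields `φ`. -/
lemma integral_jacobian_tensor_eq_zero {φ : Vec N → Vec N} (hφ : ContDiff ℝ ∞ φ)
    (hc : HasCompactSupport φ) (v : H10σ Ω) :
    ∫ x in Ω, inner ℝ (jacobian φ x) (tensor (φ x) (field v x)) = 0 := by
  obtain ⟨h1, h2⟩ := mem_H10σ_iff.1 v.2
  -- With `ψ = |φ|² / 2` one has `(v · ∇φ) · φ = v · ∇ψ`, whose integral vanishes as `div v = 0`.
  let ψ : Vec N → ℝ := fun x => ∑ i, φ x i * φ x i / 2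
  have hψ : ContDiff ℝ ∞ ψ := ContDiff.sum fun i _ =>
    ((contDiff_component hφ i).mul (contDiff_component hφ i)).div_const 2
  have hψc : HasCompactSupport ψ := HasCompactSupport.intro hc fun x hx => by
    simp [ψ, image_eq_zero_of_notMem_tsupport hx]
  have hd : ∀ x k, fderiv ℝ ψ x (EuclideanSpace.single k 1) =
      ∑ i, φ x i * jacobian φ x (i, k) := by
    intro x k
    have hi : ∀ i, HasFDerivAt (fun x => φ x i * φ x i / 2)
        (φ x i • fderiv ℝ (fun y => φ y i) x) x := by
      intro i
      have hh := ((contDiff_component hφ i).differentiable (by simp) x).hasFDerivAt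
      have h3 := (hh.mul hh).mul_const (1 / 2 : ℝ)
      refine (HasFDerivAt.congr_fderiv h3 ?_).congr_of_eventuallyEq (.of_forall fun y => ?_)
      · ext y
        simp
        ring
      · simp
        ring
    have hs : HasFDerivAt ψ (∑ i, φ x i • fderiv ℝ (fun y => φ y i) x) x :=
      HasFDerivAt.fun_sum fun i _ => hi i
    rw [hs.fderiv]
    simp [jacobian_eq_fderiv_component hφ]
  have key := integral_inner_gradVec hψ hψc h1
  have hz : ∫ x in Ω, divL Ω (v : GraphSpace Ω) x * ψ x = 0 := by
    refine integral_eq_zero_of_ae ?_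
    rw [h2]
    filter_upwards [Lp.coeFn_zero ℝ 2 (volume.restrict Ω)] with x hx
    rw [hx]; simp
  rw [hz, neg_zero] at key
  rw [← key]
  congr 1
  ext x
  rw [inner_tensor, PiLp.inner_apply]
  simp only [gradVec, hd, Finset.sum_mul]
  rw [Finset.sum_comm]
  refine Finset.sum_congr rfl fun k _ => ?_
  simp only [RCLike.inner_apply, conj_trivial, Finset.sum_mul]
  refine Finset.sum_congr rfl fun i _ => ?_
  simp only [field]
  ring

/-- The convective term vanishes when tested with the solution. -/
lemma convection_self (hN : N = 2 ∨ N = 3) (hΩ : Bornology.IsBounded Ω) (v : H10σ Ω) :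
    convection v v = 0 := by
  obtain ⟨C, hC⟩ := exists_eLpNorm_four_le hN hΩ
  have hv := (mem_H10σ_iff.1 v.2).1
  have ham : ∀ p : GraphSpace Ω, AEStronglyMeasurable p.fst (volume.restrict Ω) :=
    fun p => Lp.aestronglyMeasurable _
  have hfin : ∀ p ∈ H10 Ω, eLpNorm p.fst 4 (volume.restrict Ω) ≠ ⊤ :=
    fun p hp => ((hC p hp).trans_lt (by finiteness)).ne
  have hmem : ∀ p ∈ H10 Ω, MemLp (fun x => tensor (p.fst x) (field v x)) 2 (volume.restrict Ω) := by
    intro p hp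
    refine ⟨continuous_tensor.comp_aestronglyMeasurable ((ham p).prodMk (ham v)), ?_⟩
    refine (eLpNorm_tensor_le (ham p) (ham v)).trans_lt ?_
    exact ENNReal.mul_lt_top (hfin p hp).lt_top (hfin v hv).lt_top
  -- The transporting field `v` stays fixed and `p ↦ p ⊗ v` is bounded from `H10` to `L²`. Thus only
  -- the transported field is approximated, and the test fields need not be divergence free.
  let L : H10 Ω →ₗ[ℝ] Lp (Mat N) 2 (volume.restrict Ω) :=
    { toFun := fun p => (hmem p p.2).toLp _
      map_add' := by
        intro p q
        rw [← MemLp.toLp_add]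
        refine MemLp.toLp_congr _ _ ?_
        filter_upwards [Lp.coeFn_add (p : GraphSpace Ω).fst (q : GraphSpace Ω).fst] with x hx
        have hx' : ((p + q : H10 Ω) : GraphSpace Ω).fst x =
          (p : GraphSpace Ω).fst x + (q : GraphSpace Ω).fst x := hx
        rw [hx']
        ext i
        simp [tensor, add_mul]
      map_smul' := by
        intro c p
        rw [RingHom.id_apply, ← MemLp.toLp_const_smul]
        refine MemLp.toLp_congr _ _ ?_
        filter_upwards [Lp.coeFn_smul c (p : GraphSpace Ω).fst] with x hx
        have hx' : ((c • p : H10 Ω) : GraphSpace Ω).fst x = c • (p : GraphSpace Ω).fst x := hx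
        rw [hx']
        ext i
        simp [tensor, mul_assoc] }
  let A := (eLpNorm (field v) 4 (volume.restrict Ω)).toReal
  have hL : ∀ p, ‖L p‖ ≤ (C * A) * ‖p‖ := by
    intro p
    have h1 : ‖L p‖ ≤ (C * ‖sndL Ω p‖ₑ * eLpNorm (field v) 4 (volume.restrict Ω)).toReal := by
      have h0 : ‖L p‖ = (eLpNorm (fun x => tensor ((p : GraphSpace Ω).fst x) (field v x)) 2
          (volume.restrict Ω)).toReal := Lp.norm_toLp _ (hmem p p.2)
      rw [h0]
      refine ENNReal.toReal_mono (ENNReal.mul_ne_top (by finiteness) (hfin v hv)) ?_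
      refine (eLpNorm_tensor_le (ham p) (ham v)).trans ?_
      gcongr
      · exact hC p p.2
      · exact le_rfl
    rw [ENNReal.toReal_mul, ENNReal.toReal_mul, toReal_enorm] at h1
    refine h1.trans ?_
    have h2 : ‖sndL Ω p‖ ≤ ‖p‖ := WithLp.norm_snd_le _ (p : GraphSpace Ω)
    have h3 : (0 : ℝ) ≤ A := ENNReal.toReal_nonneg
    calc (C : ℝ) * ‖sndL Ω p‖ * A ≤ C * ‖p‖ * A := by gcongr
      _ = _ := by ring
  let T := L.mkContinuous _ hL
  have hT : ∀ p, T p = (hmem p p.2).toLp _ := fun p => rfl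
  obtain ⟨q, hq, hlim⟩ : ∃ q : ℕ → GraphSpace Ω, (∀ n, q n ∈ smoothPairs Ω) ∧
      Filter.Tendsto q Filter.atTop (nhds v) := by
    rw [H10_eq_closure] at hv
    exact mem_closure_iff_seq_limit.1 hv
  have hq' : ∀ n, q n ∈ H10 Ω := fun n => by
    rw [H10_eq_closure]
    exact Submodule.le_topologicalClosure _ (hq n)
  have hlim' : Filter.Tendsto (fun n => (⟨q n, hq' n⟩ : H10 Ω)) Filter.atTop (nhds ⟨v, hv⟩) :=
    tendsto_subtype_rng.2 hlim
  have hF : Continuous fun p : H10 Ω => inner ℝ (sndL Ω p) (T p) := by fun_prop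
  have hFlim := (hF.tendsto _).comp hlim'
  have hval : ∀ p : H10 Ω, inner ℝ (sndL Ω p) (T p) =
      ∫ x in Ω, inner ℝ ((p : GraphSpace Ω).snd x)
        (tensor ((p : GraphSpace Ω).fst x) (field v x)) := by
    intro p
    rw [L2.inner_def, hT]
    refine integral_congr_ae ?_
    filter_upwards [(hmem p p.2).coeFn_toLp] with x hx
    rw [hx]; rfl
  have hzero : ∀ n, inner ℝ (sndL Ω (q n)) (T ⟨q n, hq' n⟩) = 0 := by
    intro n
    rw [hval ⟨q n, hq' n⟩]
    obtain ⟨φ, k1, k2, -, k4, k5⟩ := hq n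
    rw [← integral_jacobian_tensor_eq_zero k1 k2 v]
    refine integral_congr_ae ?_
    filter_upwards [k4, k5] with x a b
    simp only [a, b]
  have hlast : inner ℝ (sndL Ω v) (T ⟨v, hv⟩) = 0 := by
    refine tendsto_nhds_unique hFlim (tendsto_const_nhds.congr fun n => ?_)
    exact (hzero n).symm
  rw [hval ⟨v, hv⟩] at hlast
  rw [convection, ← hlast]
  congr 1
  ext x
  rw [inner_tensor]
  rfl

end


/-! ### The functional `j`: growth, continuity, derivative along rays. -/

section

variable {N : ℕ} {Ω : Set (Vec N)} {F : ℝ → ℝ}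

namespace IsViscosityCoeff

/-- Whatever the value `F 0` is, the factor `t` makes the product zero at the origin. -/
lemma monotoneOn_Ici (hF : IsViscosityCoeff F) : MonotoneOn (fun t => t * F t) (Ici 0) := by
  intro a ha b hb hab
  rcases (mem_Ici.1 ha).eq_or_lt with rfl | ha'
  · rcases (mem_Ici.1 hb).eq_or_lt with rfl | hb'
    · exact le_rfl
    · have := hF.pos b hb'
      simp only [zero_mul]
      positivity
  · exact hF.mono ha' (ha'.trans_le hab) hab

lemma mul_apply_nonneg (hF : IsViscosityCoeff F) {t : ℝ} (ht : 0 ≤ t) : 0 ≤ t * F t := by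
  simpa using hF.monotoneOn_Ici self_mem_Ici ht ht

/-- Monotonicity gives the bound up to `t₀`; beyond it `t ^ (1 - α) ≤ 1 + t`. Linear growth here
means quadratic growth of `G`, so that `j` is finite and continuous on `H¹`. -/
lemma exists_bound (hF : IsViscosityCoeff F) :
    ∃ C, 0 ≤ C ∧ ∀ t, 0 ≤ t → t * F t ≤ C * (1 + t) := by
  obtain ⟨α, hα, t₀, ht₀, K, hK, h⟩ := hF.growth
  have h0 := hF.mul_apply_nonneg ht₀.le
  refine ⟨K + t₀ * F t₀, by positivity, fun t ht => ?_⟩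
  rcases le_total t t₀ with htt | htt
  · have h1 : t * F t ≤ t₀ * F t₀ := hF.monotoneOn_Ici ht ht₀.le htt
    nlinarith [mul_nonneg h0 ht]
  · have htp : 0 < t := ht₀.trans_le htt
    have h1 : t * F t ≤ K * (t * t ^ (-α)) := by
      calc t * F t ≤ t * (K * t ^ (-α)) := by gcongr; exact h t htt
        _ = _ := by ring
    have h2 : t * t ^ (-α) ≤ 1 + t := by
      rcases le_total t 1 with h3 | h3
      · have h4 : t ^ (-α) ≤ t ^ (-1 : ℝ) :=
          Real.rpow_le_rpow_of_exponent_ge htp h3 (by linarith [hα.2])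
        rw [Real.rpow_neg_one] at h4
        have h5 : t * t⁻¹ = 1 := mul_inv_cancel₀ htp.ne'
        nlinarith
      · have : t ^ (-α) ≤ 1 := Real.rpow_le_one_of_one_le_of_nonpos h3 (by linarith [hα.1])
        nlinarith
    nlinarith [mul_le_mul_of_nonneg_left h2 hK.le, mul_nonneg h0 ht]

lemma intervalIntegrable (hF : IsViscosityCoeff F) {a b : ℝ} (ha : 0 ≤ a) (hb : 0 ≤ b) :
    IntervalIntegrable (fun t => t * F t) volume a b := by
  refine MonotoneOn.intervalIntegrable (hF.monotoneOn_Ici.mono ?_)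
  intro x hx
  exact (le_min ha hb).trans hx.1

lemma G_sub_G (hF : IsViscosityCoeff F) {a b : ℝ} (ha : 0 ≤ a) (hb : 0 ≤ b) :
    G F b - G F a = ∫ t in a..b, t * F t :=
  intervalIntegral.integral_interval_sub_left (hF.intervalIntegrable le_rfl hb)
    (hF.intervalIntegrable le_rfl ha)

lemma abs_G_sub_le (hF : IsViscosityCoeff F) {C : ℝ} (hC : ∀ t, 0 ≤ t → t * F t ≤ C * (1 + t))
    {a b : ℝ} (ha : 0 ≤ a) (hb : 0 ≤ b) :
    |G F b - G F a| ≤ C * (1 + max a b) * |b - a| := by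
  rw [hF.G_sub_G ha hb, ← Real.norm_eq_abs]
  refine intervalIntegral.norm_integral_le_of_norm_le_const fun t ht => ?_
  have ht0 : 0 ≤ t := (le_min ha hb).trans (uIoc_subset_uIcc ht).1
  have htm : t ≤ max a b := (uIoc_subset_uIcc ht).2
  rw [Real.norm_of_nonneg (hF.mul_apply_nonneg ht0)]
  exact (hF.monotoneOn_Ici ht0 (ht0.trans htm) htm).trans (hC _ (ht0.trans htm))

lemma G_zero : G F 0 = 0 := intervalIntegral.integral_same

lemma G_nonneg (hF : IsViscosityCoeff F) {a : ℝ} (ha : 0 ≤ a) : 0 ≤ G F a :=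
  intervalIntegral.integral_nonneg ha fun _ ht => hF.mul_apply_nonneg ht.1

lemma G_le (hF : IsViscosityCoeff F) {C : ℝ} (hC : ∀ t, 0 ≤ t → t * F t ≤ C * (1 + t))
    {a : ℝ} (ha : 0 ≤ a) : G F a ≤ C * (1 + a) * a := by
  have := hF.abs_G_sub_le hC le_rfl ha
  rw [G_zero, sub_zero, sub_zero, max_eq_right ha, abs_of_nonneg ha] at this
  exact (le_abs_self _).trans this

lemma continuousOn_G (hF : IsViscosityCoeff F) : ContinuousOn (G F) (Ici 0) := by
  obtain ⟨C, hC0, hC⟩ := hF.exists_bound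
  intro a ha
  rw [ContinuousWithinAt, tendsto_iff_dist_tendsto_zero]
  have h1 : Filter.Tendsto (fun b => C * (1 + max a b) * |b - a|) (nhdsWithin a (Ici 0))
      (nhds (C * (1 + max a a) * |a - a|)) :=
    (Continuous.tendsto (by fun_prop) a).mono_left nhdsWithin_le_nhds
  rw [sub_self, abs_zero, mul_zero] at h1
  refine squeeze_zero' (.of_forall fun _ => dist_nonneg) ?_ h1
  filter_upwards [self_mem_nhdsWithin] with b hb
  exact hF.abs_G_sub_le hC ha hb

/-- The origin is excluded because `t F(t)` may jump there, as for `F(t) = t⁻¹`. -/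
lemma hasDerivAt_G (hF : IsViscosityCoeff F) {t : ℝ} (ht : 0 < t) :
    HasDerivAt (G F) (t * F t) t := by
  have hc : ContinuousOn (fun t => t * F t) (Ioi 0) :=
    continuousOn_id.mul hF.locallyLipschitz.continuousOn
  refine intervalIntegral.integral_hasDerivAt_right (hF.intervalIntegrable le_rfl ht.le) ?_
    (hc.continuousAt (Ioi_mem_nhds ht))
  exact hc.stronglyMeasurableAtFilter isOpen_Ioi t ht

lemma continuous_G_norm (hF : IsViscosityCoeff F) : Continuous fun A : Mat N => G F ‖A‖ :=
  hF.continuousOn_G.comp_continuous continuous_norm fun A => norm_nonneg A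

/-- `F` is arbitrary on negative numbers; truncation makes the function monotone on all of `ℝ`,
hence measurable. -/
lemma measurable_mul_apply_max (hF : IsViscosityCoeff F) :
    Measurable fun t : ℝ => max t 0 * F (max t 0) :=
  Monotone.measurable fun _ _ hab => hF.monotoneOn_Ici (mem_Ici.2 (le_max_right _ _))
    (mem_Ici.2 (le_max_right _ _))
    (max_le_max_right 0 hab)

end IsViscosityCoeff

lemma memLp_symGrad (v : H10σ Ω) : MemLp (symGrad v) 2 (volume.restrict Ω) :=
  (memLp_congr_ae (coeFn_symGradL v)).1 (Lp.memLp _)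

lemma symGrad_smul (c : ℝ) (v : H10σ Ω) :
    symGrad (c • v) =ᵐ[volume.restrict Ω] fun x => c • symGrad v x := by
  filter_upwards [coeFn_symGradL (c • v), coeFn_symGradL v, Lp.coeFn_smul c (symGradL Ω v)]
    with x h1 h2 h3
  rw [← h1, ← h2, map_smul, h3, Pi.smul_apply]

lemma symGrad_sub (v w : H10σ Ω) :
    symGrad (v - w) =ᵐ[volume.restrict Ω] fun x => symGrad v x - symGrad w x := by
  filter_upwards [coeFn_symGradL (v - w), coeFn_symGradL v, coeFn_symGradL w,
    Lp.coeFn_sub (symGradL Ω v) (symGradL Ω w)] with x h1 h2 h3 h4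
  rw [← h1, ← h2, ← h3, map_sub, h4, Pi.sub_apply]

lemma integral_norm_symGrad_sq (v : H10σ Ω) :
    ∫ x in Ω, ‖symGrad v x‖ ^ 2 = ‖symGradL Ω v‖ ^ 2 := by
  rw [← real_inner_self_eq_norm_sq, ← viscousForm_eq_inner, viscousForm]
  simp

lemma integral_mul_le_of_memLp_two {X : Type*} [MeasurableSpace X] {μ : Measure X} {f g : X → ℝ}
    (hf : MemLp f 2 μ) (hg : MemLp g 2 μ) :
    ∫ x, f x * g x ∂μ ≤ (eLpNorm f 2 μ).toReal * (eLpNorm g 2 μ).toReal := by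
  have h := real_inner_le_norm (hf.toLp f) (hg.toLp g)
  rw [L2.inner_def, Lp.norm_toLp, Lp.norm_toLp] at h
  refine le_of_eq_of_le (integral_congr_ae ?_) h
  filter_upwards [hf.coeFn_toLp, hg.coeFn_toLp] with x h1 h2
  rw [h1, h2]
  simp [mul_comm]

lemma j_nonneg (hF : IsViscosityCoeff F) (v : H10σ Ω) : 0 ≤ j F v :=
  integral_nonneg fun _ => hF.G_nonneg (norm_nonneg _)

variable [IsFiniteMeasure (volume.restrict Ω)]

lemma integrable_G_symGrad (hF : IsViscosityCoeff F) (v : H10σ Ω) :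
    Integrable (fun x => G F ‖symGrad v x‖) (volume.restrict Ω) := by
  obtain ⟨C, hC0, hC⟩ := hF.exists_bound
  have h2 := (memLp_symGrad v).integrable_norm_pow two_ne_zero
  refine ((((integrable_const (1 : ℝ)).add (h2.const_mul 2)).const_mul C)).mono'
    (hF.continuous_G_norm.comp_aestronglyMeasurable (memLp_symGrad v).1) (.of_forall fun x => ?_)
  have h0 := norm_nonneg (symGrad v x)
  rw [Real.norm_of_nonneg (hF.G_nonneg h0)]
  refine (hF.G_le hC h0).trans ?_
  simp only [Pi.add_apply, mul_assoc]
  gcongr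
  nlinarith [sq_nonneg (1 - ‖symGrad v x‖)]

lemma exists_j_le (hF : IsViscosityCoeff F) :
    ∃ C, ∀ v : H10σ Ω, j F v ≤ C * (1 + ‖v‖ ^ 2) := by
  obtain ⟨C, hC0, hC⟩ := hF.exists_bound
  refine ⟨C * ((volume.restrict Ω).real univ + 2 * ‖symGradL Ω‖ ^ 2), fun v => ?_⟩
  have h2 := (memLp_symGrad v).integrable_norm_pow two_ne_zero
  have h3 : j F v ≤ ∫ x in Ω, C * (1 + 2 * ‖symGrad v x‖ ^ 2) := by
    refine integral_mono (integrable_G_symGrad hF v)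
      (((integrable_const (1 : ℝ)).add (h2.const_mul 2)).const_mul C) fun x => ?_
    refine (hF.G_le hC (norm_nonneg _)).trans ?_
    simp only [mul_assoc]
    gcongr
    nlinarith [sq_nonneg (1 - ‖symGrad v x‖)]
  rw [integral_const_mul, integral_add (integrable_const _) (h2.const_mul 2), integral_const_mul,
    integral_norm_symGrad_sq] at h3
  have h4 : ‖symGradL Ω v‖ ^ 2 ≤ ‖symGradL Ω‖ ^ 2 * ‖v‖ ^ 2 := by
    rw [← mul_pow]
    gcongr
    exact (symGradL Ω).le_opNorm v
  refine h3.trans ?_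
  rw [mul_assoc]
  gcongr
  simp only [integral_const, smul_eq_mul, mul_one]
  have : 0 ≤ (volume.restrict Ω).real univ * ‖v‖ ^ 2 + 2 * ‖symGradL Ω‖ ^ 2 := by positivity
  nlinarith

lemma abs_j_sub_le (hF : IsViscosityCoeff F) {C : ℝ} (hC0 : 0 ≤ C)
    (hC : ∀ t, 0 ≤ t → t * F t ≤ C * (1 + t)) (v w : H10σ Ω) :
    |j F w - j F v| ≤ C * (‖symGradL Ω (w - v)‖ ^ 2 + ‖symGradL Ω (w - v)‖ *
      (eLpNorm (fun x => 1 + ‖symGrad v x‖) 2 (volume.restrict Ω)).toReal) := by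
  have hb : MemLp (fun x => 1 + ‖symGrad v x‖) 2 (volume.restrict Ω) :=
    MemLp.add (f := fun _ => (1 : ℝ)) (g := fun x => ‖symGrad v x‖) (memLp_const 1)
      (memLp_symGrad v).norm
  have hd := (memLp_symGrad (w - v)).integrable_norm_pow two_ne_zero
  have hm : Integrable (fun x => ‖symGrad (w - v) x‖ * (1 + ‖symGrad v x‖))
    (volume.restrict Ω) := (memLp_symGrad (w - v)).norm.integrable_mul hb
  have h0 : ∀ᵐ x ∂(volume.restrict Ω), |G F ‖symGrad w x‖ - G F ‖symGrad v x‖| ≤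
      C * (‖symGrad (w - v) x‖ ^ 2 + ‖symGrad (w - v) x‖ * (1 + ‖symGrad v x‖)) := by
    filter_upwards [symGrad_sub w v] with x hx
    have h2 := hF.abs_G_sub_le hC (norm_nonneg (symGrad v x)) (norm_nonneg (symGrad w x))
    have h3 : |‖symGrad w x‖ - ‖symGrad v x‖| ≤ ‖symGrad (w - v) x‖ := by
      rw [hx]
      exact abs_norm_sub_norm_le _ _
    have h4 : max ‖symGrad v x‖ ‖symGrad w x‖ ≤ ‖symGrad v x‖ + ‖symGrad (w - v) x‖ :=
      max_le (by linarith [norm_nonneg (symGrad (w - v) x)])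
        (by linarith [le_abs_self (‖symGrad w x‖ - ‖symGrad v x‖)])
    refine h2.trans ?_
    calc C * (1 + max ‖symGrad v x‖ ‖symGrad w x‖) * |‖symGrad w x‖ - ‖symGrad v x‖|
        ≤ C * (1 + (‖symGrad v x‖ + ‖symGrad (w - v) x‖)) * ‖symGrad (w - v) x‖ := by
          gcongr
      _ = _ := by ring
  have h1 : |j F w - j F v| ≤ ∫ x in Ω, C * (‖symGrad (w - v) x‖ ^ 2 +
      ‖symGrad (w - v) x‖ * (1 + ‖symGrad v x‖)) := by
    rw [j, j, ← integral_sub (integrable_G_symGrad hF w) (integrable_G_symGrad hF v)]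
    exact abs_integral_le_integral_abs.trans (integral_mono_ae
      ((integrable_G_symGrad hF w).sub (integrable_G_symGrad hF v)).abs
      ((hd.add hm).const_mul C) h0)
  rw [integral_const_mul, integral_add hd hm, integral_norm_symGrad_sq] at h1
  refine h1.trans ?_
  gcongr
  refine (integral_mul_le_of_memLp_two (memLp_symGrad (w - v)).norm hb).trans (le_of_eq ?_)
  rw [eLpNorm_norm, Lp.norm_def, eLpNorm_congr_ae (coeFn_symGradL (w - v))]

lemma continuous_j (hF : IsViscosityCoeff F) : Continuous (j F : H10σ Ω → ℝ) := by
  obtain ⟨C, hC0, hC⟩ := hF.exists_bound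
  rw [continuous_iff_continuousAt]
  intro v
  rw [ContinuousAt, tendsto_iff_dist_tendsto_zero]
  refine squeeze_zero (fun _ => dist_nonneg) (fun w => abs_j_sub_le hF hC0 hC v w) ?_
  generalize (eLpNorm (fun x => 1 + ‖symGrad v x‖) 2 (volume.restrict Ω)).toReal = M
  have h0 : Filter.Tendsto (fun w => ‖symGradL Ω (w - v)‖) (nhds v) (nhds 0) := by
    have : Continuous fun w => ‖symGradL Ω (w - v)‖ := by fun_prop
    simpa using this.tendsto v
  simpa using ((h0.pow 2).add (h0.mul_const M)).const_mul C

/-- The functional `j` is differentiable along rays. -/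
lemma hasDerivAt_j_smul (hF : IsViscosityCoeff F) (v : H10σ Ω) :
    HasDerivAt (fun τ : ℝ => j F ((1 + τ) • v)) (jDeriv F v v) 0 := by
  obtain ⟨C, hC0, hC⟩ := hF.exists_bound
  have hv := memLp_symGrad v
  have hD := hasDerivAt_integral_of_dominated_loc_of_deriv_le (μ := volume.restrict Ω)
    (F := fun τ x => G F ((1 + τ) * ‖symGrad v x‖)) (x₀ := 0) (s := Ioo (-1) 1)
    (F' := fun τ x => ((1 + τ) * ‖symGrad v x‖ * F ((1 + τ) * ‖symGrad v x‖)) * ‖symGrad v x‖)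
    (bound := fun x => C * (1 + 2 * ‖symGrad v x‖) * ‖symGrad v x‖)
    (Ioo_mem_nhds (by norm_num) (by norm_num)) ?_ ?_ ?_ ?_ ?_ ?_
  · have h2 := hD.2
    have e1 : ∫ x in Ω, ((1 + (0 : ℝ)) * ‖symGrad v x‖ * F ((1 + 0) * ‖symGrad v x‖)) *
        ‖symGrad v x‖ = jDeriv F v v := by
      refine integral_congr_ae (.of_forall fun x => ?_)
      simp only [add_zero, one_mul, real_inner_self_eq_norm_sq]
      ring
    rw [e1] at h2
    refine h2.congr_of_eventuallyEq ?_
    filter_upwards [Ioo_mem_nhds (show (-1 : ℝ) < 0 by norm_num) (show (0 : ℝ) < 1 by norm_num)]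
      with τ hτ
    refine integral_congr_ae ?_
    filter_upwards [symGrad_smul (1 + τ) v] with x hx
    rw [hx, norm_smul, Real.norm_of_nonneg (by linarith [hτ.1])]
  · filter_upwards [Ioo_mem_nhds (show (-1 : ℝ) < 0 by norm_num) (show (0 : ℝ) < 1 by norm_num)]
      with τ hτ
    refine (integrable_G_symGrad hF ((1 + τ) • v)).1.congr ?_
    filter_upwards [symGrad_smul (1 + τ) v] with x hx
    rw [hx, norm_smul, Real.norm_of_nonneg (by linarith [hτ.1])]
  · simpa using integrable_G_symGrad hF v
  · have h1 := (hF.measurable_mul_apply_max.comp_aemeasurable hv.1.norm.aemeasurable).mul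
      hv.1.norm.aemeasurable
    refine h1.aestronglyMeasurable.congr (.of_forall fun x => ?_)
    simp
  · refine .of_forall fun x τ hτ => ?_
    have h0 := norm_nonneg (symGrad v x)
    have h1 : 0 ≤ (1 + τ) * ‖symGrad v x‖ := by nlinarith [hτ.1]
    rw [norm_mul, norm_norm, Real.norm_of_nonneg (hF.mul_apply_nonneg h1)]
    refine mul_le_mul_of_nonneg_right ((hC _ h1).trans ?_) h0
    gcongr
    linarith [hτ.2]
  · have h2 := hv.integrable_norm_pow two_ne_zero
    have h1 : Integrable (fun x => ‖symGrad v x‖) (volume.restrict Ω) :=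
      (hv.integrable (by norm_num)).norm
    refine ((h1.add (h2.const_mul 2)).const_mul C).congr (.of_forall fun x => ?_)
    simp only [Pi.add_apply]
    ring
  · refine .of_forall fun x τ hτ => ?_
    -- Where `D(v) = 0` the integrand does not depend on `τ`, so no differentiability of `G` at `0`
    -- is required.
    rcases (norm_nonneg (symGrad v x)).eq_or_lt with h0 | h0
    · simp only [← h0, mul_zero]
      exact hasDerivAt_const _ _
    · have h1 : 0 < (1 + τ) * ‖symGrad v x‖ := mul_pos (by linarith [hτ.1]) h0
      have h2 : HasDerivAt (fun τ : ℝ => (1 + τ) * ‖symGrad v x‖) ‖symGrad v x‖ τ := by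
        simpa using ((hasDerivAt_id τ).const_add 1).mul_const ‖symGrad v x‖
      exact (hF.hasDerivAt_G h1).comp τ h2

end


/-! ### Converses of Hölder's inequality in `L²`. -/

section Duality

variable {X : Type*} [MeasurableSpace X] {μ : Measure X} [IsFiniteMeasure μ]

/-- Converse of Hölder's inequality in `L²`, for scalar functions. -/
lemma memLp_two_of_forall_integrable_mul {n : X → ℝ} (hn : AEStronglyMeasurable n μ)
    (hn0 : ∀ x, 0 ≤ n x) (h : ∀ k : X → ℝ, MemLp k 2 μ → Integrable (fun x => k x * n x) μ) :
    MemLp n 2 μ := by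
  have hmem : ∀ m : ℕ, MemLp (fun x => min (n x) m) 2 μ := fun m =>
    MemLp.of_bound (hn.inf aestronglyMeasurable_const) m (.of_forall fun x => by
      rw [Real.norm_of_nonneg (le_min (hn0 x) m.cast_nonneg)]
      exact min_le_right _ _)
  -- The truncations `min(n, m)` act on each `k ∈ L²` with the bound `∫ |k n|`, independent of `m`.
  -- Hence their `L²` norms are bounded, and the bound passes to the limit `n`.
  obtain ⟨C, hC⟩ := banach_steinhaus (g := fun m => innerSL ℝ ((hmem m).toLp _)) (fun k => by
    refine ⟨∫ x, |k x * n x| ∂μ, fun m => ?_⟩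
    rw [innerSL_apply_apply, L2.inner_def]
    refine (norm_integral_le_integral_norm _).trans (integral_mono_ae ?_
      (h k (Lp.memLp k)).abs ?_)
    · exact (L2.integrable_inner _ _).norm
    · filter_upwards [(hmem m).coeFn_toLp] with x hx
      rw [hx]
      simp only [RCLike.inner_apply, conj_trivial, norm_mul, Real.norm_eq_abs, abs_mul]
      gcongr ?_ * ?_
      rw [abs_of_nonneg (le_min (hn0 x) m.cast_nonneg), abs_of_nonneg (hn0 x)]
      exact min_le_left _ _)
  refine ⟨hn, lt_of_le_of_lt (b := ENNReal.ofReal C) ?_ ENNReal.ofReal_lt_top⟩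
  refine Lp.eLpNorm_le_of_ae_tendsto (u := Filter.atTop) (f := fun (m : ℕ) x => min (n x) m)
    (.of_forall fun m => ?_) (fun m => (hmem m).1) (.of_forall fun x => ?_)
  · have h1 := hC m
    rw [innerSL_apply_norm, Lp.norm_toLp] at h1
    exact (ENNReal.le_ofReal_iff_toReal_le (hmem m).2.ne (ENNReal.toReal_nonneg.trans h1)).2 h1
  · refine tendsto_const_nhds.congr' ?_
    filter_upwards [Filter.eventually_ge_atTop ⌈n x⌉₊] with m hm
    exact (min_eq_left (Nat.ceil_le.1 hm)).symm

variable {V : Type*} [NormedAddCommGroup V] [InnerProductSpace ℝ V] [CompleteSpace V]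

/-- Converse of Hölder's inequality in `L²`, for functions with values in the dual of a Hilbert
space. -/
lemma memLp_two_of_forall_integrable_apply {g : X → StrongDual ℝ V}
    (hg : AEStronglyMeasurable g μ)
    (h : ∀ φ : X → V, MemLp φ 2 μ → Integrable (fun x => g x (φ x)) μ) : MemLp g 2 μ := by
  rw [← memLp_norm_iff hg]
  refine memLp_two_of_forall_integrable_mul hg.norm (fun x => norm_nonneg _) fun k hk => ?_
  let r : X → V := fun x => (InnerProductSpace.toDual ℝ V).symm (g x)
  have hr : AEStronglyMeasurable r μ :=
    (InnerProductSpace.toDual ℝ V).symm.continuous.comp_aestronglyMeasurable hg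
  have hrn : ∀ x, ‖r x‖ = ‖g x‖ := fun x => LinearIsometryEquiv.norm_map _ _
  -- The unit vector along the Riesz representative makes `g(φ) = k ‖g‖`; where `g = 0` the inverse
  -- is `0` and both sides vanish.
  have hφ : MemLp (fun x => k x • (‖g x‖⁻¹ • r x)) 2 μ := by
    refine hk.of_le (hk.1.smul (AEStronglyMeasurable.smul ?_ hr)) (.of_forall fun x => ?_)
    · exact hg.norm.aemeasurable.inv.aestronglyMeasurable
    · rw [norm_smul, norm_smul, norm_inv, norm_norm, hrn]
      exact mul_le_of_le_one_right (norm_nonneg _) inv_mul_le_one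
  refine (h _ hφ).congr (.of_forall fun x => ?_)
  have h1 : g x (r x) = ‖g x‖ ^ 2 := by
    rw [← hrn, ← real_inner_self_eq_norm_sq, ← InnerProductSpace.toDual_symm_apply]
  simp only [map_smul, h1, smul_eq_mul]
  rcases eq_or_ne ‖g x‖ 0 with h0 | h0
  · simp [h0]
  · field_simp

end Duality

/-! ### Correlations of `L²` functions on the line. -/

section Correlation

variable {V : Type*} [NormedAddCommGroup V] [InnerProductSpace ℝ V]

lemma integrable_inner_of_memLp_two {X : Type*} [MeasurableSpace X] {μ : Measure X} {f g : X → V}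
    (hf : MemLp f 2 μ) (hg : MemLp g 2 μ) : Integrable (fun x => inner ℝ (f x) (g x)) μ := by
  refine (L2.integrable_inner (𝕜 := ℝ) (hf.toLp f) (hg.toLp g)).congr ?_
  filter_upwards [hf.coeFn_toLp, hg.coeFn_toLp] with x h1 h2
  rw [h1, h2]

variable {r v : ℝ → V}

/-- The correlation of two functions in `L²(ℝ)` is continuous. -/
lemma continuous_integral_inner_translate (hr : MemLp r 2 volume) (hv : MemLp v 2 volume) :
    Continuous fun σ : ℝ => ∫ t, inner ℝ (r (t + σ)) (v t) := by
  let g : ℝ → C(ℝ, ℝ) := fun σ => ⟨fun t => t + σ, by fun_prop⟩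
  have hg : Continuous g := ContinuousMap.continuous_of_continuous_uncurry _ (by
    change Continuous fun q : ℝ × ℝ => q.2 + q.1
    fun_prop)
  have hm : ∀ σ, MeasurePreserving (g σ) volume volume := fun σ => measurePreserving_add_right _ σ
  have hc : Continuous fun σ => Lp.compMeasurePreserving (g σ) (hm σ) (hr.toLp r) :=
    Continuous.compMeasurePreservingLp (E := V) (p := 2) continuous_const hg hm (by simp)
  have : (fun σ : ℝ => ∫ t, inner ℝ (r (t + σ)) (v t)) = fun σ =>
      inner ℝ (Lp.compMeasurePreserving (g σ) (hm σ) (hr.toLp r)) (hv.toLp v) := by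
    ext σ
    rw [L2.inner_def, Lp.toLp_compMeasurePreserving]
    refine integral_congr_ae ?_
    filter_upwards [hv.coeFn_toLp, (hr.comp_measurePreserving (hm σ)).coeFn_toLp] with t h1 h2
    rw [h1, h2]
    rfl
  rw [this]
  exact hc.inner continuous_const

/-- Prepares Fubini: by translation invariance the integral over `t` of the norm is at most `‖r‖² +
‖v‖²` for every `σ`. -/
lemma integrable_inner_translate (hrs : StronglyMeasurable r) (hvs : StronglyMeasurable v)
    (hr : MemLp r 2 volume) (hv : MemLp v 2 volume) (h : ℝ) :
    Integrable (fun q : ℝ × ℝ => inner ℝ (r (q.2 + q.1)) (v q.2))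
      ((volume.restrict (uIoc 0 h)).prod volume) := by
  have hm : StronglyMeasurable fun q : ℝ × ℝ => (inner ℝ (r (q.2 + q.1)) (v q.2) : ℝ) :=
    (hrs.comp_measurable (measurable_snd.add measurable_fst)).inner
      (hvs.comp_measurable measurable_snd)
  have htr : ∀ σ : ℝ, MemLp (fun t => r (t + σ)) 2 volume := fun σ =>
    hr.comp_measurePreserving (measurePreserving_add_right volume σ)
  have hi2 : ∀ σ : ℝ, ∫ t, ‖r (t + σ)‖ ^ 2 = ∫ t, ‖r t‖ ^ 2 := fun σ =>
    integral_add_right_eq_self (fun t => ‖r t‖ ^ 2) σ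
  have : IsFiniteMeasure (volume.restrict (uIoc 0 h)) := ⟨by simp [uIoc]⟩
  rw [integrable_prod_iff hm.aestronglyMeasurable]
  refine ⟨.of_forall fun σ => integrable_inner_of_memLp_two (htr σ) hv, ?_⟩
  refine (integrable_const ((∫ t, ‖r t‖ ^ 2) + ∫ t, ‖v t‖ ^ 2)).mono'
    hm.norm.integral_prod_right.aestronglyMeasurable (.of_forall fun σ => ?_)
  have i1 := (htr σ).integrable_norm_pow two_ne_zero
  have i2 := hv.integrable_norm_pow two_ne_zero
  rw [Real.norm_of_nonneg (integral_nonneg fun _ => norm_nonneg _), ← hi2 σ,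
    ← integral_add i1 i2]
  refine integral_mono (integrable_inner_of_memLp_two (htr σ) hv).norm (i1.add i2) fun t => ?_
  refine (norm_inner_le_norm _ _).trans ?_
  nlinarith [sq_nonneg (‖r (t + σ)‖ - ‖v t‖), sq_nonneg (‖r (t + σ)‖), sq_nonneg (‖v t‖)]

lemma integrable_intervalIntegral_inner_translate (hrs : StronglyMeasurable r)
    (hvs : StronglyMeasurable v) (hr : MemLp r 2 volume) (hv : MemLp v 2 volume) (h : ℝ) :
    Integrable (fun t => ∫ σ in (0 : ℝ)..h, inner ℝ (r (t + σ)) (v t)) volume := by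
  simp only [intervalIntegral.intervalIntegral_eq_integral_uIoc]
  exact ((integrable_inner_translate hrs hvs hr hv h).integral_prod_right).smul
    (if (0 : ℝ) ≤ h then (1 : ℝ) else -1)

lemma integral_intervalIntegral_inner_translate (hrs : StronglyMeasurable r)
    (hvs : StronglyMeasurable v) (hr : MemLp r 2 volume) (hv : MemLp v 2 volume) (h : ℝ) :
    ∫ t, ∫ σ in (0 : ℝ)..h, inner ℝ (r (t + σ)) (v t) =
      ∫ σ in (0 : ℝ)..h, ∫ t, inner ℝ (r (t + σ)) (v t) := by
  simp only [intervalIntegral.intervalIntegral_eq_integral_uIoc, smul_eq_mul]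
  rw [integral_const_mul]
  congr 1
  exact (integral_integral_swap (integrable_inner_translate hrs hvs hr hv h)).symm

end Correlation

/-! ### The energy identity on the extended time line. -/

section Energy

variable {V H : Type*} [NormedAddCommGroup V] [InnerProductSpace ℝ V] [NormedAddCommGroup H]
  [InnerProductSpace ℝ H]

/-- The energy identity of Lions and Magenes, for functions extended to negative times by their
initial value. -/
lemma ae_norm_sq_sub_eq (ι : V →L[ℝ] H) {T : ℝ} {u r : ℝ → V} {u₀ : V}
    (hus : StronglyMeasurable u) (hrs : StronglyMeasurable r)
    (hu : ∀ a b : ℝ, MemLp u 2 (volume.restrict (Ioc a b))) (hr : MemLp r 2 volume)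
    (hu0 : ∀ t ≤ 0, u t = u₀) (hr0 : ∀ t ≤ 0, r t = 0)
    (hrep : ∀ᵐ t : ℝ, t < T → ∀ w, inner ℝ (ι (u t)) (ι w) =
      inner ℝ (ι u₀) (ι w) + ∫ s in (0 : ℝ)..t, inner ℝ (r s) w) :
    ∀ᵐ τ : ℝ, τ ∈ Ioo 0 T →
      ‖ι (u τ)‖ ^ 2 - ‖ι u₀‖ ^ 2 = 2 * ∫ s in (0 : ℝ)..τ, inner ℝ (r s) (u s) := by
  set Φ : ℝ → ℝ := fun t => ‖ι (u t)‖ ^ 2 with hΦdef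
  have hΦ : ∀ a b, IntervalIntegrable Φ volume a b := by
    have : ∀ a b, IntegrableOn Φ (Ioc a b) volume := fun a b =>
      (ι.comp_memLp' (hu a b)).integrable_norm_pow two_ne_zero
    exact fun a b => ⟨this a b, this b a⟩
  have hΦl : LocallyIntegrable Φ volume := by
    intro x
    refine ⟨Ioc (x - 1) (x + 1), Ioc_mem_nhds (by linarith) (by linarith), ?_⟩
    exact (hΦ (x - 1) (x + 1)).1
  have hr_loc : ∀ (w : V) (a b : ℝ), IntervalIntegrable (fun s => inner ℝ (r s) w) volume a b := by
    intro w a b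
    have : ∀ a b, IntegrableOn (fun s => inner ℝ (r s) w) (Ioc a b) volume := fun a b =>
      integrable_inner_of_memLp_two (hr.restrict _) (memLp_const w)
    exact ⟨this a b, this b a⟩
  filter_upwards [LocallyIntegrable.ae_hasDerivAt_integral hΦl] with τ hτd hτ
  set v : ℝ → V := (Ioc (-1) τ).indicator u with hvdef
  have hvs : StronglyMeasurable v := hus.indicator measurableSet_Ioc
  have hv : MemLp v 2 volume := (memLp_indicator_iff_restrict measurableSet_Ioc).2 (hu _ _)
  set m : ℝ → ℝ := fun σ => ∫ t, inner ℝ (r (t + σ)) (v t) with hmdef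
  have hm : Continuous m := continuous_integral_inner_translate hr hv
  have hm0 : m 0 = ∫ s in (0 : ℝ)..τ, inner ℝ (r s) (u s) := by
    rw [intervalIntegral.integral_of_le hτ.1.le, ← integral_indicator measurableSet_Ioc]
    refine integral_congr_ae (.of_forall fun t => ?_)
    simp only [add_zero, hvdef]
    by_cases h1 : t ∈ Ioc 0 τ
    · rw [indicator_of_mem h1,
        indicator_of_mem (show t ∈ Ioc (-1) τ from ⟨by linarith [h1.1], h1.2⟩)]
    · rw [indicator_of_notMem h1]
      by_cases h2 : t ∈ Ioc (-1) τ
      · rw [hr0 t (not_lt.1 fun h3 => h1 ⟨h3, h2.2⟩), inner_zero_left]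
      · rw [indicator_of_notMem h2, inner_zero_right]
  set P : ℝ → ℝ := fun x => ∫ t in (0 : ℝ)..x, Φ t with hPdef
  -- Integrate `|u(t+h)|² - |u(t)|² ≥ 2 (u(t+h) - u(t), u(t)) = 2 ∫₀ʰ ⟨r(t+σ), u(t)⟩ dσ` over `t ∈
  -- (-1, τ)`. The left side telescopes, its lower end giving `h |u₀|²`, and the result is `e(h) ≥
  -- 0` for small `h` of either sign. As `e(0) = 0`, the derivative of `e` at `0` vanishes, which is
  -- the claim at a point `τ` where the primitive of `|u|²` is differentiable.
  set e : ℝ → ℝ := fun h => P (τ + h) - P τ - h * ‖ι u₀‖ ^ 2 - 2 * ∫ σ in (0 : ℝ)..h, m σ with hedef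
  have he0 : e 0 = 0 := by simp [hedef]
  have hPneg : ∀ x ≤ 0, P x = x * ‖ι u₀‖ ^ 2 := by
    intro x hx
    have : P x = ∫ t in (0 : ℝ)..x, ‖ι u₀‖ ^ 2 := by
      refine intervalIntegral.integral_congr fun t ht => ?_
      rw [uIcc_of_ge hx] at ht
      simp only [hΦdef, hu0 t ht.2]
    rw [this]
    simp
  have hed : HasDerivAt e (Φ τ - ‖ι u₀‖ ^ 2 - 2 * m 0) 0 := by
    have h1 : HasDerivAt (fun h => P (τ + h)) (Φ τ) 0 := by
      have := hτd 0
      have h2 : HasDerivAt P (Φ τ) (τ + 0) := by simpa using this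
      exact h2.comp_const_add τ 0
    have h3 : HasDerivAt (fun h => ∫ σ in (0 : ℝ)..h, m σ) (m 0) 0 :=
      intervalIntegral.integral_hasDerivAt_right (by simp)
        (hm.stronglyMeasurable.stronglyMeasurableAtFilter) hm.continuousAt
    have h4 : HasDerivAt (fun h : ℝ => h * ‖ι u₀‖ ^ 2) (‖ι u₀‖ ^ 2) 0 := by
      simpa using (hasDerivAt_id (0 : ℝ)).mul_const (‖ι u₀‖ ^ 2)
    exact ((h1.sub_const _).sub h4).sub (h3.const_mul 2)
  have hmin : IsLocalMin e 0 := by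
    -- `h < 1` keeps `-1 + h` among the negative times, where `u = u₀`; `h < T - τ` keeps `t + h`
    -- below `T`, where the representation holds.
    have hδ : 0 < min 1 (T - τ) := lt_min one_pos (by linarith [hτ.2])
    filter_upwards [Ioo_mem_nhds (neg_lt_zero.2 hδ) hδ] with h hh
    rw [he0]
    have hh1 : h < 1 := hh.2.trans_le (min_le_left _ _)
    have hh2 : h < T - τ := hh.2.trans_le (min_le_right _ _)
    have hh3 : -1 < h := (neg_le_neg (min_le_left 1 (T - τ))).trans_lt hh.1
    have hshift : ∀ᵐ t : ℝ, t + h < T → ∀ w, inner ℝ (ι (u (t + h))) (ι w) =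
        inner ℝ (ι u₀) (ι w) + ∫ s in (0 : ℝ)..(t + h), inner ℝ (r s) w :=
      (measurePreserving_add_right volume h).quasiMeasurePreserving.ae hrep
    have hineq : ∀ᵐ t ∂(volume.restrict (Ioc (-1) τ)),
        2 * (∫ σ in (0 : ℝ)..h, inner ℝ (r (t + σ)) (v t)) ≤ Φ (t + h) - Φ t := by
      filter_upwards [ae_restrict_of_ae hrep, ae_restrict_of_ae hshift,
        ae_restrict_mem measurableSet_Ioc] with t h1 h2 ht
      have h3 := h1 (ht.2.trans_lt hτ.2) (u t)
      have h4 := h2 (by linarith [ht.2]) (u t)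
      have h5 : ∫ σ in (0 : ℝ)..h, inner ℝ (r (t + σ)) (v t) =
          inner ℝ (ι (u (t + h))) (ι (u t)) - inner ℝ (ι (u t)) (ι (u t)) := by
        rw [h3, h4, hvdef, indicator_of_mem ht,
          intervalIntegral.integral_comp_add_left (fun s => inner ℝ (r s) (u t)) t, add_zero,
          ← intervalIntegral.integral_interval_sub_left (hr_loc _ 0 _) (hr_loc _ 0 _)]
        ring
      rw [h5, real_inner_self_eq_norm_sq]
      have h6 := sq_nonneg ‖ι (u (t + h)) - ι (u t)‖
      rw [norm_sub_sq_real] at h6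
      simp only [hΦdef]
      linarith
    have hint1 := integrable_intervalIntegral_inner_translate hrs hvs hr hv h
    have hs : IntervalIntegrable (fun t => Φ (t + h)) volume (-1) τ := by
      simpa using (hΦ (-1 + h) (τ + h)).comp_add_right h enorm_ne_top
    have hle : (-1 : ℝ) ≤ τ := by linarith [hτ.1]
    have hmono := integral_mono_ae (hint1.restrict.const_mul 2)
      ((hs.sub (hΦ (-1) τ)).1) hineq
    rw [integral_const_mul] at hmono
    have hall : ∫ t in Ioc (-1) τ, ∫ σ in (0 : ℝ)..h, inner ℝ (r (t + σ)) (v t) =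
        ∫ σ in (0 : ℝ)..h, m σ := by
      rw [← integral_intervalIntegral_inner_translate hrs hvs hr hv h]
      refine setIntegral_eq_integral_of_forall_compl_eq_zero fun t ht => ?_
      simp [hvdef, indicator_of_notMem ht]
    rw [hall, ← intervalIntegral.integral_of_le hle] at hmono
    rw [intervalIntegral.integral_sub hs (hΦ _ _),
      intervalIntegral.integral_comp_add_right] at hmono
    have e1 : ∫ t in (-1 + h)..(τ + h), Φ t = P (τ + h) - P (-1 + h) :=
      (intervalIntegral.integral_interval_sub_left (hΦ _ _) (hΦ _ _)).symm
    have e2 : ∫ t in (-1)..τ, Φ t = P τ - P (-1) :=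
      (intervalIntegral.integral_interval_sub_left (hΦ _ _) (hΦ _ _)).symm
    rw [e1, e2, hPneg (-1 + h) (by linarith), hPneg (-1) (by norm_num)] at hmono
    simp only [hedef]
    linarith
  have hz := hmin.hasDerivAt_eq_zero hed
  rw [← hm0]
  linarith

end Energy

/-! ### Scalar weak derivatives on an interval. -/

section WeakDerivative

variable {T : ℝ}

/-- The primitive of a test function with integral zero is a test function. -/
lemma exists_primitive {η : ℝ → ℝ} (hη : ContDiff ℝ ∞ η) (hc : HasCompactSupport η)
    (hs : tsupport η ⊆ Ioo 0 T) (h0 : ∫ t, η t = 0) :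
    ∃ ψ : ℝ → ℝ, ContDiff ℝ ∞ ψ ∧ HasCompactSupport ψ ∧ tsupport ψ ⊆ Ioo 0 T ∧ deriv ψ = η := by
  rcases (tsupport η).eq_empty_or_nonempty with he | hne
  · have : η = 0 := tsupport_eq_empty_iff.1 he
    exact ⟨0, contDiff_const, HasCompactSupport.zero, by simp, by rw [this]; simp⟩
  obtain ⟨a, ha⟩ := hc.isCompact.exists_isLeast hne
  obtain ⟨b, hb⟩ := hc.isCompact.exists_isGreatest hne
  have hzero : ∀ t, t ∉ Icc a b → η t = 0 := fun t ht =>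
    image_eq_zero_of_notMem_tsupport fun h => ht ⟨ha.2 h, hb.2 h⟩
  have hint : ∀ x y, IntervalIntegrable η volume x y := fun x y =>
    hη.continuous.intervalIntegrable x y
  have hd : ∀ t, HasDerivAt (fun t => ∫ s in a..t, η s) (η t) t := fun t =>
    intervalIntegral.integral_hasDerivAt_right (hint _ _)
      hη.continuous.stronglyMeasurable.stronglyMeasurableAtFilter hη.continuous.continuousAt
  have hderiv : deriv (fun t => ∫ s in a..t, η s) = η := funext fun t => (hd t).deriv
  have hout : ∀ t, t ∉ Icc a b → ∫ s in a..t, η s = 0 := by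
    intro t ht
    rcases lt_or_ge t a with h | h
    · rw [intervalIntegral.integral_symm, intervalIntegral.integral_of_le h.le,
        ← integral_Ico_eq_integral_Ioc]
      rw [setIntegral_eq_zero_of_forall_eq_zero fun s hs => hzero s fun h' => ?_, neg_zero]
      exact absurd hs.2 (not_lt.2 h'.1)
    · have hbt : b < t := not_le.1 fun h' => ht ⟨h, h'⟩
      rw [intervalIntegral.integral_of_le h, ← integral_Icc_eq_integral_Ioc,
        setIntegral_eq_integral_of_forall_compl_eq_zero fun s hs => hzero s fun h' => ?_, h0]
      exact hs ⟨h'.1, h'.2.trans hbt.le⟩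
  have hsub : tsupport (fun t => ∫ s in a..t, η s) ⊆ Icc a b :=
    closure_minimal (fun t ht => by_contra fun h => ht (hout t h)) isClosed_Icc
  refine ⟨fun t => ∫ s in a..t, η s, ?_, HasCompactSupport.intro isCompact_Icc hout, ?_, hderiv⟩
  · rw [contDiff_infty_iff_deriv, hderiv]
    exact ⟨fun t => (hd t).differentiableAt, hη⟩
  · exact hsub.trans fun t ht => ⟨(hs ha.1).1.trans_le ht.1, ht.2.trans_lt (hs hb.1).2⟩

/-- The lemma of du Bois-Reymond. -/
lemma exists_ae_eq_const_of_integral_deriv_mul_eq_zero (hT : 0 < T) {z : ℝ → ℝ}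
    (hz : IntegrableOn z (Ioo 0 T) volume)
    (h : ∀ ψ : ℝ → ℝ, ContDiff ℝ ∞ ψ → HasCompactSupport ψ → tsupport ψ ⊆ Ioo 0 T →
      ∫ t in Ioo 0 T, deriv ψ t * z t = 0) :
    ∃ c, ∀ᵐ t ∂(timeMeasure T), z t = c := by
  -- A fixed bump of integral one: for any test function `η` the difference `η - (∫ η) ρ'` has mean
  -- zero, so it is the derivative of a test function. This identifies the constant as `∫ ρ' z`.
  let ρ : ContDiffBump (T / 2) := ⟨T / 8, T / 4, by linarith, by linarith⟩
  set ρ' : ℝ → ℝ := ρ.normed volume with hρ'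
  have hρ1 : ContDiff ℝ ∞ ρ' := ρ.contDiff_normed
  have hρ2 : HasCompactSupport ρ' := ρ.hasCompactSupport_normed
  have hρ3 : tsupport ρ' ⊆ Ioo 0 T := by
    rw [hρ', ρ.tsupport_normed_eq, Real.closedBall_eq_Icc]
    intro t ht
    have h1 : T / 2 - T / 4 ≤ t := ht.1
    have h2 : t ≤ T / 2 + T / 4 := ht.2
    exact ⟨by linarith, by linarith⟩
  have hρ4 : ∫ t, ρ' t = 1 := ρ.integral_normed
  set c := ∫ t in Ioo 0 T, ρ' t * z t with hcdef
  have hmul : ∀ η : ℝ → ℝ, ContDiff ℝ ∞ η → HasCompactSupport η →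
      IntegrableOn (fun t => η t * z t) (Ioo 0 T) volume := by
    intro η h1 h2
    obtain ⟨C, hC⟩ := h1.continuous.bounded_above_of_compact_support h2
    exact hz.bdd_mul h1.continuous.aestronglyMeasurable (.of_forall hC)
  refine ⟨c, ?_⟩
  have key := isOpen_Ioo.ae_eq_zero_of_integral_contDiff_smul_eq_zero (μ := volume)
    (f := (Ioo 0 T).indicator fun t => z t - c) (U := Ioo 0 T) ?_ ?_
  · rw [ae_restrict_iff' measurableSet_Ioo]
    filter_upwards [key] with t ht hmem
    have := ht hmem
    rw [indicator_of_mem hmem] at this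
    linarith
  · have : IntegrableOn (fun t => z t - c) (Ioo 0 T) volume :=
      hz.sub (integrableOn_const (by simp) (by simp))
    exact ((integrable_indicator_iff measurableSet_Ioo).2
      this).locallyIntegrable.locallyIntegrableOn _
  · intro η h1 h2 h3
    have hη : Integrable η := h1.continuous.integrable_of_hasCompactSupport h2
    have hρi : Integrable ρ' := hρ1.continuous.integrable_of_hasCompactSupport hρ2
    set d := ∫ t, η t with hd
    have hηs : ∫ t in Ioo 0 T, η t = d := setIntegral_eq_integral_of_forall_compl_eq_zero
      fun t ht => image_eq_zero_of_notMem_tsupport fun h' => ht (h3 h')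
    obtain ⟨ψ, k1, k2, k3, k4⟩ := exists_primitive (T := T) (η := fun t => η t - d * ρ' t)
      (h1.sub (contDiff_const.mul hρ1)) (h2.sub hρ2.mul_left)
      ((tsupport_sub η _).trans (union_subset h3 ((tsupport_mul_subset_right).trans hρ3)))
      (by rw [integral_sub hη (hρi.const_mul d), integral_const_mul, hρ4]; simp [hd])
    have h4 := h ψ k1 k2 k3
    rw [k4] at h4
    have h5 : ∫ t in Ioo 0 T, (η t - d * ρ' t) * z t =
        (∫ t in Ioo 0 T, η t * z t) - d * c := by
      rw [hcdef, ← integral_const_mul, ← integral_sub (hmul η h1 h2)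
        ((hmul ρ' hρ1 hρ2).const_mul d)]
      congr 1
      ext t
      ring
    have h6 : ∫ t, η t • (Ioo 0 T).indicator (fun t => z t - c) t =
        ∫ t in Ioo 0 T, η t * (z t - c) := by
      rw [← integral_indicator measurableSet_Ioo]
      congr 1
      ext t
      by_cases ht : t ∈ Ioo 0 T
      · simp [indicator_of_mem ht]
      · simp [indicator_of_notMem ht]
    have h7 : ∫ t in Ioo 0 T, η t * (z t - c) = (∫ t in Ioo 0 T, η t * z t) - d * c := by
      rw [← hηs, ← integral_mul_const, ← integral_sub (hmul η h1 h2)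
        (hη.integrableOn.mul_const c)]
      congr 1
      ext t
      ring
    rw [h6, h7, ← h5, h4]

/-- A scalar function with an integrable weak derivative and with an initial value is the primitive
of its weak derivative. -/
lemma ae_eq_add_integral_of_weak_deriv (hT : 0 < T) {y g c : ℝ → ℝ}
    (hy : IntegrableOn y (Ioo 0 T) volume) (hg : IntegrableOn g (Ioo 0 T) volume)
    (hweak : ∀ ψ : ℝ → ℝ, ContDiff ℝ ∞ ψ → HasCompactSupport ψ → tsupport ψ ⊆ Ioo 0 T →
      ∫ t in Ioo 0 T, ψ t * g t = - ∫ t in Ioo 0 T, deriv ψ t * y t)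
    (hc : ContinuousOn c (Icc 0 T)) (hyc : ∀ᵐ t ∂(timeMeasure T), y t = c t) :
    ∀ᵐ t ∂(timeMeasure T), y t = c 0 + ∫ s in (0 : ℝ)..t, g s := by
  have hgi : IntervalIntegrable g volume 0 T :=
    (intervalIntegrable_iff_integrableOn_Ioo_of_le hT.le).2 hg
  set P : ℝ → ℝ := fun t => ∫ s in (0 : ℝ)..t, g s with hP
  have hPac : AbsolutelyContinuousOnInterval P 0 T :=
    hgi.absolutelyContinuousOnInterval_intervalIntegral left_mem_uIcc
  have hPc : ContinuousOn P (Icc 0 T) := by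
    simpa [uIcc_of_le hT.le] using hPac.continuousOn
  have hPi : IntegrableOn P (Ioo 0 T) volume :=
    (hPc.integrableOn_Icc).mono_set Ioo_subset_Icc_self
  -- `P` has derivative `g` only almost everywhere, so integration by parts is taken in its form for
  -- absolutely continuous functions.
  have hparts : ∀ ψ : ℝ → ℝ, ContDiff ℝ ∞ ψ → tsupport ψ ⊆ Ioo 0 T →
      ∫ t in Ioo 0 T, deriv ψ t * P t = - ∫ t in Ioo 0 T, ψ t * g t := by
    intro ψ h1 h3
    have hψac : AbsolutelyContinuousOnInterval ψ 0 T :=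
      (h1.contDiffOn.of_le (by simp)).absolutelyContinuousOnInterval
    have h4 := hPac.integral_mul_deriv_eq_deriv_mul hψac
    have hψ0 : ψ 0 = 0 := image_eq_zero_of_notMem_tsupport fun h => lt_irrefl _ (h3 h).1
    have hψT : ψ T = 0 := image_eq_zero_of_notMem_tsupport fun h => lt_irrefl _ (h3 h).2
    rw [hψ0, hψT, mul_zero, mul_zero, sub_zero, zero_sub] at h4
    have h5 : ∫ x in (0 : ℝ)..T, deriv P x * ψ x = ∫ x in (0 : ℝ)..T, ψ x * g x := by
      refine intervalIntegral.integral_congr_ae ?_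
      filter_upwards [hgi.ae_hasDerivAt_integral] with x hx hmem
      rw [(hx (uIoc_subset_uIcc hmem) 0 left_mem_uIcc).deriv, mul_comm]
    rw [h5, intervalIntegral.integral_of_le hT.le, intervalIntegral.integral_of_le hT.le,
      integral_Ioc_eq_integral_Ioo, integral_Ioc_eq_integral_Ioo] at h4
    rw [← h4]
    simp only [mul_comm]
  obtain ⟨k, hk⟩ := exists_ae_eq_const_of_integral_deriv_mul_eq_zero hT (hy.sub hPi)
    (fun ψ h1 h2 h3 => by
      obtain ⟨C, hC⟩ := (h1.continuous_deriv (by simp)).bounded_above_of_compact_support h2.deriv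
      have hm : ∀ f : ℝ → ℝ, IntegrableOn f (Ioo 0 T) volume →
          IntegrableOn (fun t => deriv ψ t * f t) (Ioo 0 T) volume := fun f hf =>
        hf.bdd_mul (h1.continuous_deriv (by simp)).aestronglyMeasurable (.of_forall hC)
      simp only [Pi.sub_apply, mul_sub]
      rw [integral_sub (hm y hy) (hm P hPi), hparts ψ h1 h3, hweak ψ h1 h2 h3]
      ring)
  -- The continuous function `c - P` equals `k` almost everywhere on `[0, T]`, hence also at the
  -- endpoint `0`.
  have hk0 : c 0 - P 0 = k := by
    have h1 : (fun t => c t - P t) =ᵐ[volume.restrict (Icc 0 T)] fun _ => k := by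
      rw [restrict_Ioo_eq_restrict_Icc.symm]
      filter_upwards [hk, hyc] with t h1 h2
      rw [← h2, ← h1]; rfl
    exact Measure.eqOn_Icc_of_ae_eq volume hT.ne h1 (hc.sub hPc) continuousOn_const
      (left_mem_Icc.2 hT.le)
  have hP0 : P 0 = 0 := intervalIntegral.integral_same
  filter_upwards [hk] with t ht
  have : y t - P t = k := ht
  linarith

end WeakDerivative

/-! ### The energy identity for weak time derivatives. -/

section Energy

variable {V H : Type*} [NormedAddCommGroup V] [InnerProductSpace ℝ V] [CompleteSpace V]
  [SecondCountableTopology V] [NormedAddCommGroup H] [InnerProductSpace ℝ H]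

/-- The energy identity of Lions and Magenes: `‖u(t)‖² = ‖u₀‖² + 2 ∫₀ᵗ ⟨u', u⟩`. -/
theorem ae_norm_sq_eq_of_weak_deriv (ι : V →L[ℝ] H) {T : ℝ} (hT : 0 < T) {u : ℝ → V}
    {g : ℝ → StrongDual ℝ V} {u₀ : V} (hu : MemLp u 2 (timeMeasure T))
    (hg : MemLp g 2 (timeMeasure T))
    (hweak : ∀ ψ : ℝ → ℝ, ContDiff ℝ ∞ ψ → HasCompactSupport ψ → tsupport ψ ⊆ Ioo 0 T → ∀ w : V,
      ∫ t in Ioo 0 T, ψ t * g t w = - ∫ t in Ioo 0 T, deriv ψ t * inner ℝ (ι (u t)) (ι w))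
    (hinit : ∀ w : V, ∃ c : ℝ → ℝ, ContinuousOn c (Icc 0 T) ∧
      (∀ᵐ t ∂(timeMeasure T), inner ℝ (ι (u t)) (ι w) = c t) ∧ c 0 = inner ℝ (ι u₀) (ι w)) :
    ∀ᵐ t ∂(timeMeasure T), ‖ι (u t)‖ ^ 2 = ‖ι u₀‖ ^ 2 + 2 * ∫ s in (0 : ℝ)..t, g s (u s) := by
  have hgint : Integrable g (timeMeasure T) := hg.integrable (by norm_num)
  have hgi : ∀ {t}, t ∈ Ioo 0 T → IntervalIntegrable g volume 0 t := fun {t} ht =>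
    (intervalIntegrable_iff_integrableOn_Ioo_of_le ht.1.le).2
      (hgint.mono_measure (Measure.restrict_mono (Ioo_subset_Ioo_right ht.2.le) le_rfl))
  have hrep : ∀ᵐ t ∂(timeMeasure T), ∀ w, inner ℝ (ι (u t)) (ι w) =
      inner ℝ (ι u₀) (ι w) + ∫ s in (0 : ℝ)..t, g s w := by
    have h1 : ∀ w, ∀ᵐ t ∂(timeMeasure T), inner ℝ (ι (u t)) (ι w) =
        inner ℝ (ι u₀) (ι w) + ∫ s in (0 : ℝ)..t, g s w := by
      intro w
      obtain ⟨c, hc1, hc2, hc3⟩ := hinit w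
      rw [← hc3]
      refine ae_eq_add_integral_of_weak_deriv hT ?_ (hgint.apply_continuousLinearMap w)
        (fun ψ a b c => hweak ψ a b c w) hc1 hc2
      exact ((ι.comp_memLp' hu).integrable (by norm_num)).inner_const (ι w)
    -- The null set in `h1` depends on `w`; a countable dense set of `w` and continuity in `w`
    -- remove this dependence.
    have h2 := ae_all_iff.2 fun n => h1 (TopologicalSpace.denseSeq V n)
    filter_upwards [h2, ae_restrict_mem measurableSet_Ioo] with t ht hmem w
    have e1 : ∀ w, ∫ s in (0 : ℝ)..t, g s w = (∫ s in (0 : ℝ)..t, g s) w := fun w =>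
      (ContinuousLinearMap.intervalIntegral_apply (hgi hmem) w).symm
    simp only [e1] at ht ⊢
    refine congrFun (Continuous.ext_on (TopologicalSpace.denseRange_denseSeq V)
      (f := fun w => (inner ℝ (ι (u t)) (ι w) : ℝ))
      (g := fun w => inner ℝ (ι u₀) (ι w) + (∫ s in (0 : ℝ)..t, g s) w)
      (by fun_prop) (by fun_prop) ?_) w
    rintro _ ⟨n, rfl⟩
    exact ht n
  -- Strongly measurable versions, extended as `ae_norm_sq_sub_eq` requires: `u` by `u₀` to negative
  -- times, the Riesz representative of `g` by zero.
  let u₁ : ℝ → V := (Iic 0).indicator (fun _ => u₀) + (Ioo 0 T).indicator (hu.1.mk u)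
  let R : ℝ → V := fun t => (InnerProductSpace.toDual ℝ V).symm (hg.1.mk g t)
  let r : ℝ → V := (Ioo 0 T).indicator R
  have hRs : StronglyMeasurable R :=
    (InnerProductSpace.toDual ℝ V).symm.continuous.comp_stronglyMeasurable
      hg.1.stronglyMeasurable_mk
  have hus : StronglyMeasurable u₁ :=
    (stronglyMeasurable_const.indicator measurableSet_Iic).add
      (hu.1.stronglyMeasurable_mk.indicator measurableSet_Ioo)
  have hrs : StronglyMeasurable r := hRs.indicator measurableSet_Ioo
  have hu₁ : ∀ a b : ℝ, MemLp u₁ 2 (volume.restrict (Ioc a b)) := by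
    intro a b
    refine ((memLp_const u₀).indicator measurableSet_Iic).add (MemLp.restrict _ ?_)
    exact (memLp_indicator_iff_restrict measurableSet_Ioo).2 ((memLp_congr_ae hu.1.ae_eq_mk).1 hu)
  have hr : MemLp r 2 volume := by
    refine (memLp_indicator_iff_restrict measurableSet_Ioo).2 ?_
    refine ((memLp_congr_ae hg.1.ae_eq_mk).1 hg).of_le hRs.aestronglyMeasurable
      (.of_forall fun t => ?_)
    exact (LinearIsometryEquiv.norm_map _ _).le
  have hu0 : ∀ t ≤ 0, u₁ t = u₀ := by
    intro t ht
    simp [u₁, ht, not_lt.2 ht]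
  have hr0 : ∀ t ≤ 0, r t = 0 := by
    intro t ht
    simp [r, not_lt.2 ht]
  have huu : ∀ᵐ t ∂(timeMeasure T), u₁ t = u t := by
    filter_upwards [hu.1.ae_eq_mk, ae_restrict_mem measurableSet_Ioo] with t h1 h2
    simp [u₁, h2.1, h2.2, h1, not_le.2 h2.1]
  have hrr : ∀ᵐ t ∂(timeMeasure T), ∀ w, inner ℝ (r t) w = g t w := by
    filter_upwards [hg.1.ae_eq_mk, ae_restrict_mem measurableSet_Ioo] with t h1 h2 w
    rw [h1]
    simp only [r, indicator_of_mem h2, R]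
    exact InnerProductSpace.toDual_symm_apply
  have hII : ∀ {t}, t ∈ Ioo 0 T → ∀ {p q : ℝ → ℝ}, (∀ᵐ s ∂(timeMeasure T), p s = q s) →
      ∫ s in (0 : ℝ)..t, p s = ∫ s in (0 : ℝ)..t, q s := by
    intro t ht p q hpq
    rw [ae_restrict_iff' measurableSet_Ioo] at hpq
    refine intervalIntegral.integral_congr_ae ?_
    filter_upwards [hpq] with s hs hmem
    rw [uIoc_of_le ht.1.le] at hmem
    exact hs ⟨hmem.1, hmem.2.trans_lt ht.2⟩
  have hcore := ae_norm_sq_sub_eq ι (T := T) hus hrs hu₁ hr hu0 hr0 (by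
    have h1 := hrep
    have h2 := huu
    rw [ae_restrict_iff' measurableSet_Ioo] at h1 h2
    filter_upwards [h1, h2] with t h3 h4 htT w
    rcases le_or_gt t 0 with ht | ht
    · rw [hu0 t ht, intervalIntegral.integral_congr (g := fun _ => (0 : ℝ))]
      · simp
      · intro s hs
        rw [uIcc_of_ge ht] at hs
        simp [hr0 s hs.2]
    · rw [h4 ⟨ht, htT⟩, h3 ⟨ht, htT⟩ w]
      congr 1
      exact (hII ⟨ht, htT⟩ (hrr.mono fun s hs => hs w)).symm)
  filter_upwards [ae_restrict_of_ae hcore, huu, ae_restrict_mem measurableSet_Ioo] with t h1 h2 h3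
  have h4 := h1 h3
  rw [h2, hII h3 (q := fun s => g s (u s)) ?_] at h4
  · linarith
  · filter_upwards [huu, hrr] with s h5 h6
    rw [h5, h6]

end Energy

/-! ### Power laws, and the energy equality from the variational inequality. -/

section

lemma isViscosityCoeff_rpow_neg {α : ℝ} (hα : α ∈ Icc (0 : ℝ) 1) :
    IsViscosityCoeff fun t => t ^ (-α) where
  pos t ht := Real.rpow_pos_of_pos ht _
  locallyLipschitz := by
    have h : ContDiffOn ℝ 1 (fun t : ℝ => t ^ (-α)) (Ioi 0) := fun t ht =>
      (Real.contDiffAt_rpow_const_of_ne (ne_of_gt ht)).contDiffWithinAt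
    exact h.locallyLipschitzOn (convex_Ioi 0)
  mono := by
    intro a ha b hb hab
    have h : ∀ t : ℝ, 0 < t → t * t ^ (-α) = t ^ (1 - α) := fun t ht => by
      rw [sub_eq_add_neg, Real.rpow_add ht, Real.rpow_one]
    simp only [h a ha, h b hb]
    exact Real.rpow_le_rpow (le_of_lt ha) hab (by linarith [hα.2])
  growth := ⟨α, hα, 1, one_pos, 1, one_pos, fun t _ => by rw [one_mul]⟩

/-- Since `G(t) = t ^ (2 - α) / (2 - α)`, the equation reduces to `θ ^ (1 - α) = 1 / (2 - α)`. For
`α = 1` both sides are `1` and any `θ > 0` would do. -/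
lemma exists_G_rpow_neg_eq {α : ℝ} (hα : α ∈ Icc (0 : ℝ) 1) :
    ∃ θ > 0, ∀ t > 0, G (fun t => t ^ (-α)) t = θ * t ^ 2 * (θ * t) ^ (-α) := by
  have h2 : 0 < 2 - α := by linarith [hα.2]
  obtain ⟨θ, hθ, hθα⟩ : ∃ θ : ℝ, 0 < θ ∧ θ ^ (1 - α) = (2 - α)⁻¹ := by
    rcases hα.2.eq_or_lt with h1 | h1
    · exact ⟨1, one_pos, by rw [h1]; norm_num⟩
    · refine ⟨(2 - α)⁻¹ ^ (1 - α)⁻¹, by positivity, ?_⟩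
      rw [← Real.rpow_mul (by positivity), inv_mul_cancel₀ (by linarith), Real.rpow_one]
  refine ⟨θ, hθ, fun t ht => ?_⟩
  have hG : G (fun t => t ^ (-α)) t = ∫ s in (0 : ℝ)..t, s ^ (1 - α) := by
    refine intervalIntegral.integral_congr_ae (.of_forall fun s hs => ?_)
    rw [uIoc_of_le ht.le] at hs
    rw [sub_eq_add_neg, Real.rpow_add hs.1, Real.rpow_one]
  rw [hG, integral_rpow (Or.inl (by linarith [hα.2])), Real.zero_rpow (by linarith),
    Real.mul_rpow hθ.le ht.le]
  have e1 : θ * θ ^ (-α) = (2 - α)⁻¹ := by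
    rw [← hθα, sub_eq_add_neg, Real.rpow_add hθ, Real.rpow_one]
  have e2 : t ^ (1 - α + 1) = t ^ 2 * t ^ (-α) := by
    rw [← Real.rpow_natCast t 2, ← Real.rpow_add ht]
    congr 1
    push_cast
    ring
  calc (t ^ (1 - α + 1) - 0) / (1 - α + 1) = (2 - α)⁻¹ * (t ^ 2 * t ^ (-α)) := by
        rw [e2, show 1 - α + 1 = 2 - α by ring]
        field_simp
        ring
    _ = θ * t ^ 2 * (θ ^ (-α) * t ^ (-α)) := by
        rw [← e1]
        ring

variable {N : ℕ} {Ω : Set (Vec N)} {F : ℝ → ℝ} {T : ℝ}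

lemma integrable_apply_of_memLp_two {X V : Type*} [MeasurableSpace X] {μ : Measure X}
    [NormedAddCommGroup V] [NormedSpace ℝ V] {f : X → StrongDual ℝ V} {u : X → V}
    (hf : MemLp f 2 μ) (hu : MemLp u 2 μ) : Integrable (fun x => f x (u x)) μ := by
  refine (hf.norm.integrable_mul hu.norm).mono' ?_ (.of_forall fun x => (f x).le_opNorm _)
  exact isBoundedBilinearMap_apply.continuous.comp_aestronglyMeasurable (hf.1.prodMk hu.1)

lemma integrable_j_comp [IsFiniteMeasure (volume.restrict Ω)] (hF : IsViscosityCoeff F)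
    {u : ℝ → H10σ Ω} (hu : MemLp u 2 (timeMeasure T)) :
    Integrable (fun t => j F (u t)) (timeMeasure T) := by
  obtain ⟨C, hC⟩ := exists_j_le (Ω := Ω) hF
  refine (((integrable_const (1 : ℝ)).add (hu.integrable_norm_pow two_ne_zero)).const_mul C).mono'
    ((continuous_j hF).comp_aestronglyMeasurable hu.1) (.of_forall fun t => ?_)
  rw [Real.norm_of_nonneg (j_nonneg hF _)]
  exact hC _

lemma integrable_viscousForm_self {u : ℝ → H10σ Ω} (hu : MemLp u 2 (timeMeasure T)) :
    Integrable (fun t => viscousForm (u t) (u t)) (timeMeasure T) := by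
  simp only [viscousForm_self]
  exact (((gradL Ω).comp_memLp' hu).integrable_norm_pow two_ne_zero).const_mul _

lemma viscousForm_smul_right (c : ℝ) (v w : H10σ Ω) :
    viscousForm v (c • w) = c * viscousForm v w := by
  rw [viscousForm_eq_inner, viscousForm_eq_inner, map_smul, inner_smul_right]

lemma convection_smul_self (hN : N = 2 ∨ N = 3) (hΩ : Bornology.IsBounded Ω) (c : ℝ)
    (v : H10σ Ω) : convection v (c • v) = 0 := by
  have h : convection v (c • v) = c * convection v v := by
    rw [convection, convection, ← integral_const_mul]
    refine integral_congr_ae ?_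
    filter_upwards [Lp.coeFn_smul c (field v)] with x hx
    have hx' : field (c • v) x = c • field v x := hx
    rw [hx', Finset.mul_sum]
    refine Finset.sum_congr rfl fun i _ => ?_
    simp only [PiLp.smul_apply, smul_eq_mul]
    ring
  rw [h, convection_self hN hΩ, mul_zero]

lemma integral_add_add_sub {X : Type*} [MeasurableSpace X] {μ : Measure X} {p q r s : X → ℝ}
    (hp : Integrable p μ) (hq : Integrable q μ) (hr : Integrable r μ) (hs : Integrable s μ) :
    ∫ x, (p x + q x + r x - s x) ∂μ =
      (∫ x, p x ∂μ) + (∫ x, q x ∂μ) + (∫ x, r x ∂μ) - ∫ x, s x ∂μ := by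
  have h1 : Integrable (fun x => p x + q x) μ := hp.add hq
  have h2 : Integrable (fun x => p x + q x + r x) μ := h1.add hr
  rw [integral_sub h2 hs, integral_add h1 hr, integral_add hp hq]

/-- Testing the variational inequality with multiples of the solution on a set of times. -/
lemma ae_nonneg_of_variational_inequality (hN : N = 2 ∨ N = 3) (hΩ : Bornology.IsBounded Ω)
    [IsFiniteMeasure (volume.restrict Ω)] (hF : IsViscosityCoeff F)
    {f u' : ℝ → Hneg1σ Ω} (hf : MemLp f 2 (timeMeasure T)) {u : ℝ → H10σ Ω}
    (hu : MemLp u 2 (timeMeasure T)) (hu' : Integrable (fun t => u' t (u t)) (timeMeasure T))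
    (hvi : ∀ φ : ℝ → H10σ Ω, MemLp φ 2 (timeMeasure T) →
      (∫ t in Ioo 0 T, u' t (φ t - u t)) + (∫ t in Ioo 0 T, viscousForm (u t) (φ t - u t))
          - (∫ t in Ioo 0 T, convection (u t) (φ t)) + (∫ t in Ioo 0 T, (j F (φ t) - j F (u t)))
        ≥ ∫ t in Ioo 0 T, f t (φ t - u t)) (c : ℝ) :
    ∀ᵐ t ∂(timeMeasure T),
      0 ≤ c * (u' t (u t) + viscousForm (u t) (u t) - f t (u t)) +
        (j F ((1 + c) • u t) - j F (u t)) := by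
  have hfu := integrable_apply_of_memLp_two hf hu
  have hvu := integrable_viscousForm_self hu
  have hj := integrable_j_comp hF (hu.const_smul (1 + c))
  have hj0 := integrable_j_comp hF hu
  refine ae_nonneg_of_forall_setIntegral_nonneg
    ((((hu'.add hvu).sub hfu).const_mul c).add (hj.sub hj0)) fun A hA _ => ?_
  -- Localisation in time: the test function is `(1 + c) u` on `A` and `u` elsewhere, so only the
  -- times in `A` contribute.
  let k : ℝ → ℝ := A.indicator fun _ => c
  have hk : ∀ q : ℝ → ℝ, Integrable q (timeMeasure T) →
      Integrable (fun t => k t * q t) (timeMeasure T) := by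
    intro q hq
    refine ((hq.const_mul c).indicator hA).congr (.of_forall fun t => ?_)
    by_cases ht : t ∈ A <;> simp [k, ht]
  have hφ : MemLp (fun t => (1 + k t) • u t) 2 (timeMeasure T) := by
    refine (hu.add ((hu.const_smul c).indicator hA)).ae_eq (.of_forall fun t => ?_)
    by_cases ht : t ∈ A <;> simp [k, ht, add_smul]
  have hdiff : ∀ t, (1 + k t) • u t - u t = k t • u t := fun t => by
    rw [add_smul, one_smul, add_sub_cancel_left]
  have h := hvi _ hφ
  have hjd : Integrable (fun t => j F ((1 + k t) • u t) - j F (u t)) (timeMeasure T) :=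
    (integrable_j_comp hF hφ).sub hj0
  simp only [hdiff, map_smul, smul_eq_mul, viscousForm_smul_right,
    convection_smul_self hN hΩ, integral_zero, sub_zero] at h
  have h1 := integral_add_add_sub (hk _ hu') (hk _ hvu) hjd (hk _ hfu)
  rw [← integral_indicator hA]
  refine le_of_le_of_eq (sub_nonneg.2 h) (h1.symm.trans (integral_congr_ae ?_))
  refine .of_forall fun t => ?_
  by_cases ht : t ∈ A
  · simp only [k, indicator_of_mem ht]
    ring
  · simp [k, ht]

/-- The variational inequality, tested with multiples of the solution, is an equation. -/
lemma ae_eq_neg_jDeriv [IsFiniteMeasure (volume.restrict Ω)] (hF : IsViscosityCoeff F)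
    {a : ℝ → ℝ} {u : ℝ → H10σ Ω}
    (h : ∀ c : ℝ, ∀ᵐ t ∂(timeMeasure T), 0 ≤ c * a t + (j F ((1 + c) • u t) - j F (u t))) :
    ∀ᵐ t ∂(timeMeasure T), a t = - jDeriv F (u t) (u t) := by
  -- Rational `c` share one null set of times; continuity of `j` then gives all real `c`.
  filter_upwards [ae_all_iff.2 fun q : ℚ => h q] with t ht
  have hcont : Continuous fun c : ℝ => c * a t + (j F ((1 + c) • u t) - j F (u t)) :=
    (continuous_id.mul continuous_const).add
      (((continuous_j hF).comp (by fun_prop)).sub continuous_const)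
  have hall : ∀ c : ℝ, 0 ≤ c * a t + (j F ((1 + c) • u t) - j F (u t)) := fun c =>
    Rat.isDenseEmbedding_coe_real.dense.induction_on
      (p := fun c : ℝ => 0 ≤ c * a t + (j F ((1 + c) • u t) - j F (u t))) c
      (isClosed_le continuous_const hcont) ht
  have hmin : IsLocalMin (fun c : ℝ => c * a t + (j F ((1 + c) • u t) - j F (u t))) 0 :=
    .of_forall fun c => by simpa using hall c
  have hd : HasDerivAt (fun c : ℝ => c * a t + (j F ((1 + c) • u t) - j F (u t)))
      (1 * a t + jDeriv F (u t) (u t)) 0 :=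
    ((hasDerivAt_id (0 : ℝ)).mul_const (a t)).add ((hasDerivAt_j_smul hF (u t)).sub_const _)
  linarith [hmin.hasDerivAt_eq_zero hd]

/-- The energy equality for weak solutions. Since `j` is differentiable along rays also where
`D(u) = 0`, testing with multiples of `u` identifies the dissipation as `⟨j'(u), u⟩`, so that the
scaling factor is `1`. -/
theorem IsWeakSolution.energy_equality (hN : N = 2 ∨ N = 3) (hΩ : Bornology.IsBounded Ω)
    (hT : 0 < T) (hF : IsViscosityCoeff F) {u₀ : H10σ Ω} {f : ℝ → Hneg1σ Ω}
    (hf : MemLp f 2 (timeMeasure T)) {u : ℝ → H10σ Ω} (h : IsWeakSolution F T u₀ f u) :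
    Integrable (fun s => jDeriv F (u s) (u s)) (timeMeasure T) ∧
    ∀ᵐ t ∂(timeMeasure T), 1 / 2 * ‖field (u t)‖ ^ 2
        + 1 / 2 * (∫ s in (0 : ℝ)..t, ‖grad (u s)‖ ^ 2)
        + (∫ s in (0 : ℝ)..t, jDeriv F (u s) (u s))
      = 1 / 2 * ‖field u₀‖ ^ 2 + ∫ s in (0 : ℝ)..t, f s (u s) := by
  have : IsFiniteMeasure (volume.restrict Ω) := ⟨by simpa using hΩ.measure_lt_top⟩
  obtain ⟨hu, -, hinit, u', hu'p, hweak, hvi⟩ := h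
  -- The test function `φ = 0` gives integrability of `⟨u', u⟩`; adding it back for general `φ`
  -- leaves `⟨u', φ⟩`, and the converse of Hölder's inequality applies to `u'`.
  have hu'u : Integrable (fun t => u' t (u t)) (timeMeasure T) := by
    refine ((hvi _ MemLp.zero).1.neg).congr (.of_forall fun t => ?_)
    simp
  have hu'2 : MemLp u' 2 (timeMeasure T) := by
    refine memLp_two_of_forall_integrable_apply hu'p.1 fun φ hφ => ?_
    refine ((hvi φ hφ).1.add hu'u).congr (.of_forall fun t => ?_)
    simp
  have hae := ae_eq_neg_jDeriv hF
    (ae_nonneg_of_variational_inequality hN hΩ hF hf hu hu'u fun φ hφ => (hvi φ hφ).2.2)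
  have henergy := ae_norm_sq_eq_of_weak_deriv (fieldL Ω) hT hu hu'2 hweak hinit
  have hfu := integrable_apply_of_memLp_two hf hu
  have hgu : Integrable (fun t => ‖grad (u t)‖ ^ 2) (timeMeasure T) :=
    ((gradL Ω).comp_memLp' hu).integrable_norm_pow two_ne_zero
  have hj : Integrable (fun s => jDeriv F (u s) (u s)) (timeMeasure T) := by
    refine (((hu'u.add (hgu.const_mul (1 / 2))).sub hfu).neg).congr ?_
    filter_upwards [hae] with t ht
    rw [viscousForm_self] at ht
    simp only [Pi.neg_apply, Pi.sub_apply, Pi.add_apply]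
    linarith
  refine ⟨hj, ?_⟩
  filter_upwards [henergy, ae_restrict_mem measurableSet_Ioo] with t ht hmem
  have hI : ∀ q : ℝ → ℝ, Integrable q (timeMeasure T) → IntervalIntegrable q volume 0 t :=
    fun q hq => (intervalIntegrable_iff_integrableOn_Ioo_of_le hmem.1.le).2
      (hq.mono_measure (Measure.restrict_mono (Ioo_subset_Ioo_right hmem.2.le) le_rfl))
  have hae' := hae
  rw [ae_restrict_iff' measurableSet_Ioo] at hae'
  have h1 : ∫ s in (0 : ℝ)..t, jDeriv F (u s) (u s) =
      ∫ s in (0 : ℝ)..t, (f s (u s) - u' s (u s) - 1 / 2 * ‖grad (u s)‖ ^ 2) := by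
    refine intervalIntegral.integral_congr_ae ?_
    filter_upwards [hae'] with s hs hmem'
    rw [uIoc_of_le hmem.1.le] at hmem'
    have h2 := hs ⟨hmem'.1, hmem'.2.trans_lt hmem.2⟩
    rw [viscousForm_self] at h2
    linarith
  rw [intervalIntegral.integral_sub ((hI _ hfu).sub (hI _ hu'u)) ((hI _ hgu).const_mul _),
    intervalIntegral.integral_sub (hI _ hfu) (hI _ hu'u), intervalIntegral.integral_const_mul] at h1
  simp only [fieldL_apply] at ht
  linarith

end


end ShearThinning

end

theorem propositionB1 :
    (∀ α ∈ Set.Icc (0 : ℝ) 1,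
      ShearThinning.IsViscosityCoeff (fun t => t ^ (-α)) ∧
      ∃ θ > 0, ∀ t > 0,
        ShearThinning.G (fun t => t ^ (-α)) t = θ * t ^ 2 * (θ * t) ^ (-α)) ∧
    ∀ (N : ℕ) (_ : N = 2 ∨ N = 3) (Ω : Set (ShearThinning.Vec N)) (_ : IsOpen Ω)
      (_ : Bornology.IsBounded Ω) (T : ℝ) (_ : 0 < T)
      (F : ℝ → ℝ) (_ : ShearThinning.IsViscosityCoeff F)
      (_ : ∃ θ > 0, ∀ t ∈ Set.Ioo 0 T, ShearThinning.G F t = θ * t ^ 2 * F (θ * t))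
      (u₀ : ShearThinning.H10σ Ω)
      (f : ℝ → ShearThinning.Hneg1σ Ω) (_ : MemLp f 2 (ShearThinning.timeMeasure T))
      (u : ℝ → ShearThinning.H10σ Ω) (_ : ShearThinning.IsWeakSolution F T u₀ f u),
      ∃ η : ℝ → ℝ, (∀ t ∈ Set.Ioo 0 T, η t ∈ Set.Ioc (0 : ℝ) 1) ∧
        (∀ᵐ s ∂(ShearThinning.timeMeasure T),
          HasDerivAt (fun τ : ℝ => ShearThinning.j F (η s • u s + τ • u s))
            (ShearThinning.jDeriv F (η s • u s) (u s)) 0) ∧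
        Integrable (fun s => (η s)⁻¹ * ShearThinning.jDeriv F (η s • u s) (u s))
          (ShearThinning.timeMeasure T) ∧
        ∀ᵐ t ∂(ShearThinning.timeMeasure T),
          1 / 2 * ‖ShearThinning.field (u t)‖ ^ 2
              + 1 / 2 * (∫ s in (0 : ℝ)..t, ‖ShearThinning.grad (u s)‖ ^ 2)
              + (∫ s in (0 : ℝ)..t, (η s)⁻¹ * ShearThinning.jDeriv F (η s • u s) (u s))
            = 1 / 2 * ‖ShearThinning.field u₀‖ ^ 2 + ∫ s in (0 : ℝ)..t, f s (u s) := by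
  refine ⟨fun α hα => ⟨ShearThinning.isViscosityCoeff_rpow_neg hα,
    ShearThinning.exists_G_rpow_neg_eq hα⟩, ?_⟩
  intro N hN Ω _ hΩ T hT F hF _ u₀ f hf u h
  have : IsFiniteMeasure (volume.restrict Ω) := ⟨by simpa using hΩ.measure_lt_top⟩
  obtain ⟨hj, henergy⟩ := h.energy_equality hN hΩ hT hF hf
  refine ⟨fun _ => 1, fun _ _ => ⟨one_pos, le_rfl⟩, .of_forall fun s => ?_, ?_, ?_⟩
  · simpa only [one_smul, add_smul] using ShearThinning.hasDerivAt_j_smul hF (u s)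
  · simpa only [one_smul, inv_one, one_mul] using hj
  · simpa only [one_smul, inv_one, one_mul] using henergy
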